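/- Let $\alpha\in\mathbb R$, $\beta>0$, and let $(X_n)_{n\ge0}$ be the self-interacting nearest-neighbour walk on $\mathbb Z$ with $X_0=0$ whose law is given, for all $n\ge0$, by $$\mathbf P\big(X_{n+1}=X_n\pm1\mid \mathcal F_n\big)=\frac{e^{\pm\beta\Delta_n}}{e^{\beta\Delta_n}+e^{-\beta\Delta_n}},\qquad \mathcal F_n=\sigma(X_0,\dots,X_n),$$ where $\Delta_n=\Delta(n,X_n)$, $$\Delta(n,j)=-\alpha\,\ell(n,j-1)+\ell(n,j)-\ell(n,j+1)+\alpha\,\ell(n,j+2),$$ and $\ell(n,j)=\#\{1\le m\le n:\{X_{m-1},X_m\}=\{j-1,j\}\}$ is the local time on the unoriented edge between $j-1$ and $j$. Let $\mathcal L$ be the (possibly empty, possibly infinite) set of sites that the walk visits infinitely often. Put $\alpha_1=+\infty$ and $\alpha_L=\dfrac1{1+2\cos(2\pi/(L+2))}$ for $L\ge2$. Then for every integer $L\ge1$: (i) If $\alpha\in(\alpha_{L+1},\alpha_L)$, then $\#\mathcal L=L+2$ with positive probability. (ii) If $\alpha<\alpha_{L+1}$, then almost surely $\#\mathcal L>L+2$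 unless $\mathcal L=\emptyset$, and the walk is never eventually confined to $L+2$ sites: almost surely, for every $n_0$, the set $\{X_n:n\ge n_0\}$ has more than $L+2$ elements. In particular, if $\alpha\le1/3$, then almost surely $\#\mathcal L\in\{0,\infty\}$, and for every $n_0$ the set $\{X_n:n\ge n_0\}$ is infinite; that is, the walk is almost surely never trapped in a finite interval. -/

import Mathlib

open MeasureTheory ProbabilityTheory Filter

/-- The local time `ℓ(n,j)` of the path `x` on the unoriented edge `j = {j-1, j}`:
the number of steps `1 ≤ m ≤ n` that go along this edge, in either direction. -/
def localTime (x : ℕ → ℤ) (n : ℕ) (j : ℤ) : ℕ :=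
  ((Finset.Icc 1 n).filter
    (fun m => ({x (m - 1), x m} : Finset ℤ) = {j - 1, j})).card

/-- `Δ(n,j) = -α ℓ(n,j-1) + ℓ(n,j) - ℓ(n,j+1) + α ℓ(n,j+2)`. -/
def localStream (α : ℝ) (x : ℕ → ℤ) (n : ℕ) (j : ℤ) : ℝ :=
  -α * (localTime x n (j - 1) : ℝ) + (localTime x n j : ℝ)
    - (localTime x n (j + 1) : ℝ) + α * (localTime x n (j + 2) : ℝ)

/-- `X` is a realization, on the probability space `(Ω, P)`, of the walk with parameters
`α` and `β`: it starts from `0`, and conditionally on `ℱ_n = σ(X_0, …, X_n)` it steps by `±1`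
with probability `exp(±β Δ_n) / (exp(β Δ_n) + exp(-β Δ_n))`, where `Δ_n = Δ(n, X_n)`. -/
structure IsPushedWalk (α β : ℝ) {Ω : Type*} [MeasurableSpace Ω] (P : Measure Ω)
    (X : ℕ → Ω → ℤ) : Prop where
  measurable : ∀ n, Measurable (X n)
  start : ∀ᵐ ω ∂P, X 0 ω = 0
  step_right : ∀ n,
    P⟦{ω | X (n + 1) ω = X n ω + 1} |
        Filtration.natural X (fun k => (measurable k).stronglyMeasurable) n⟧
      =ᵐ[P] fun ω =>
        Real.exp (β * localStream α (fun k => X k ω) n (X n ω)) /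
          (Real.exp (β * localStream α (fun k => X k ω) n (X n ω)) +
            Real.exp (-(β * localStream α (fun k => X k ω) n (X n ω))))
  step_left : ∀ n,
    P⟦{ω | X (n + 1) ω = X n ω - 1} |
        Filtration.natural X (fun k => (measurable k).stronglyMeasurable) n⟧
      =ᵐ[P] fun ω =>
        Real.exp (-(β * localStream α (fun k => X k ω) n (X n ω))) /
          (Real.exp (β * localStream α (fun k => X k ω) n (X n ω)) +
            Real.exp (-(β * localStream α (fun k => X k ω) n (X n ω))))

/-- The set `𝓛` of sites that the path `x` visits infinitely often. -/
def visitedInfinitelyOften (x : ℕ → ℤ) : Set ℤ :=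
  {j | ∃ᶠ n in atTop, x n = j}

/-- The set of sites that the path `x` visits at some time `n ≥ n₀`. -/
def sitesVisitedFrom (x : ℕ → ℤ) (n₀ : ℕ) : Set ℤ :=
  {j | ∃ n, n₀ ≤ n ∧ x n = j}

/-- The critical values: `α_1 = ∞` and `α_L = 1 / (1 + 2 cos (2π / (L + 2)))` for `L ≥ 2`.
The index `0` is never used. -/
noncomputable def criticalAlpha (L : ℕ) : EReal :=
  if L ≤ 1 then ⊤
  else ((1 / (1 + 2 * Real.cos (2 * Real.pi / ((L : ℝ) + 2))) : ℝ) : EReal)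

/-! Suppose that the walk stays from some time on in an interval with inner edges `1, …, N`, and let
`v` be the vector of local times on these edges. Up to a bounded error the streams are linear in
`v`, and the walk drives the inner ones towards balance. Balance is the recursion `streamForm α u =
0` with `u 0 = u (N + 1) = 0`, so `v` should become proportional to such a `u`, and the stream at
the left end should grow like a positive multiple of `α u(-1) n`. Its sign decides: if `u (-1) < 0`
the walk is pushed out, while inward streams of linear size at both ends make the escape
probabilities exponentially small. The recursion has the characteristic roots `1, e^{±2it}` with `α
(1 + 2 cos 2t) = 1`, and the explicit profile has `u (-1) = -2 sin (t (N + 2)) sin t`, whose sign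
changes at `t (N + 2) = π`. With `N = L` this is `α = α_L`. For `0 < α ≤ 1/3` the angle is zero or
imaginary and `u (-1) < 0` for every `N`; for `α ≤ 0` the end streams visibly point outwards.

Convergence to the profile is an energy argument. For `α > 0`, `energy` is a nonnegative quadratic
form whose kernel, among `v` vanishing at `0` and `N + 1`, is the line spanned by `u`. Crossing edge
`e` changes it, up to a constant, by `2 (u (e+1) s_e - u (e-1) s_{e-1})`, where `s` is the stream
(`energy_add_single`). With suitable corrections (`lyapunov`) the only unbounded gains come from
steps against the stream, which are so unlikely that the drift is bounded (`drift_le`). The ends do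
no harm because `u` vanishes there.

The walk conditioned step by step to stay in the interval is encoded by the density `stayWeight`.
The weighted mean energy at time `n` is `O(n)` (`exists_integral_energy_le`), whereas a deviation of
order `n` from the profile costs energy of order `n ^ 2`. Summing along the squares gives
`ae_tendsto_energy`; on confinement the density is at least `1`, so the conclusion holds for the
walk itself.

For (ii), an outward profile keeps the stream at the left end bounded above, and conditional
Borel–Cantelli forces infinitely many exits (`ae_not_confined_of_outward`). For (i), as long as the
energies are small the density is bounded by a constant `B`; this has weighted probability at least
`1/2`, so the walk stays forever with probability at least `1/(2B)` (`confined_pos`), and the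
positivity of `u` makes it visit every site infinitely often. -/

/-! ### The quadratic energy of a local-time profile -/

/-- The linear form `-α v(y-1) + v(y) - v(y+1) + α v(y+2)`. -/
def streamForm (α : ℝ) (v : ℤ → ℝ) (y : ℤ) : ℝ :=
  -α * v (y - 1) + v y - v (y + 1) + α * v (y + 2)

/-- Two solutions `u`, `p` of `streamForm α · = 0`, where `u` is positive exactly on the edges
`1, …, N`, vanishes at both ends, and has positive Wronskian with `p`. -/
structure StreamProfile (α : ℝ) (N : ℕ) where
  u : ℤ → ℝ
  p : ℤ → ℝ
  u_stream : ∀ j, streamForm α u j = 0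
  p_stream : ∀ j, streamForm α p j = 0
  u_zero : u 0 = 0
  u_end : u (N + 1) = 0
  u_pos : ∀ j : ℤ, 1 ≤ j → j ≤ N → 0 < u j
  wronskian_pos : ∀ e : ℤ, 0 ≤ e → e ≤ N → 0 < u e * p (e + 1) - u (e + 1) * p e

namespace StreamProfile

variable {α : ℝ} {N : ℕ} (S : StreamProfile α N)

/-- The Wronskian of `u` and `v`. -/
def wr (v : ℤ → ℝ) (e : ℤ) : ℝ := S.u e * v (e + 1) - S.u (e + 1) * v e

/-- The `3 × 3` determinant of `v`, `p`, `u` at `k-1, k, k+1`. -/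
def det (v : ℤ → ℝ) (k : ℤ) : ℝ :=
  -(v (k - 1) * S.wr S.p k) + v k * (S.u (k - 1) * S.p (k + 1) - S.u (k + 1) * S.p (k - 1))
    - v (k + 1) * S.wr S.p (k - 1)

/-- The weight of the square of `det` at `k` in the energy. -/
noncomputable def coeff (k : ℤ) : ℝ := α * S.u k / (S.wr S.p (k - 1) * S.wr S.p k)

/-- The energy of a profile. -/
noncomputable def energy (v : ℤ → ℝ) : ℝ := ∑ k ∈ Finset.Icc (0 : ℤ) (N + 1), S.coeff k * S.det v k ^ 2

lemma wr_pos {e : ℤ} (h0 : 0 ≤ e) (h1 : e ≤ N) : 0 < S.wr S.p e := S.wronskian_pos e h0 h1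

lemma u_nonneg {j : ℤ} (h0 : 0 ≤ j) (h1 : j ≤ N + 1) : 0 ≤ S.u j := by
  rcases h0.eq_or_lt with h | h
  · rw [← h, S.u_zero]
  rcases h1.eq_or_lt with h' | h'
  · rw [h', S.u_end]
  exact (S.u_pos j (by omega) (by omega)).le

lemma coeff_nonneg (hα : 0 < α) {k : ℤ} (h0 : 0 ≤ k) (h1 : k ≤ N + 1) : 0 ≤ S.coeff k := by
  unfold coeff
  rcases h0.eq_or_lt with h | h
  · rw [← h, S.u_zero]; simp
  rcases h1.eq_or_lt with h' | h'
  · rw [h', S.u_end]; simp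
  have := S.u_pos k (by omega) (by omega)
  have := S.wr_pos (e := k) (by omega) (by omega)
  have := S.wr_pos (e := k - 1) (by omega) (by omega)
  positivity

lemma coeff_pos (hα : 0 < α) {k : ℤ} (h0 : 1 ≤ k) (h1 : k ≤ N) : 0 < S.coeff k := by
  unfold coeff
  have := S.u_pos k (by omega) (by omega)
  have := S.wr_pos (e := k) (by omega) (by omega)
  have := S.wr_pos (e := k - 1) (by omega) (by omega)
  positivity

lemma energy_nonneg (hα : 0 < α) (v : ℤ → ℝ) : 0 ≤ S.energy v :=
  Finset.sum_nonneg fun k hk => by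
    rw [Finset.mem_Icc] at hk
    exact mul_nonneg (S.coeff_nonneg hα hk.1 hk.2) (sq_nonneg _)

lemma coeff_mul_det_sq_le (hα : 0 < α) (v : ℤ → ℝ) {k : ℤ} (h0 : 0 ≤ k) (h1 : k ≤ N + 1) :
    S.coeff k * S.det v k ^ 2 ≤ S.energy v := by
  refine Finset.single_le_sum (f := fun k => S.coeff k * S.det v k ^ 2) (fun k hk => ?_)
    (Finset.mem_Icc.2 ⟨h0, h1⟩)
  rw [Finset.mem_Icc] at hk
  exact mul_nonneg (S.coeff_nonneg hα hk.1 hk.2) (sq_nonneg _)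

lemma det_add (v w : ℤ → ℝ) (k : ℤ) : S.det (v + w) k = S.det v k + S.det w k := by
  simp only [det, Pi.add_apply]; ring

/-- Expanded along the row of `v`, one determinant has the coefficient `-wr S.p e` at `v (e - 1)`,
the other has it at `v (e + 2)`; the recursions for `u` and `p` adjust the two middle coefficients.
The stream is thus a discrete derivative of `det`, and this makes the energy computation telescope.
-/
lemma streamForm_wr_eq (v : ℤ → ℝ) (e : ℤ) :
    S.wr S.p e * streamForm α v e = α * (S.det v e - S.det v (e + 1)) := by
  have h1 := S.u_stream e
  have h2 := S.p_stream e
  simp only [streamForm, det, wr] at *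
  rw [show e + 1 - 1 = e by ring, show e + 1 + 1 = e + 2 by ring, show e - 1 + 1 = e by ring]
  linear_combination (S.p (e + 1) * v e - S.p e * v (e + 1)) * h1 +
    (S.u e * v (e + 1) - S.u (e + 1) * v e) * h2

/-- Desnanot–Jacobi identity for the `3 × 3` determinant. It recovers the Wronskians of `u` and `v`
from `det` by a recursion in `k`. -/
lemma wr_wr (v : ℤ → ℝ) (k : ℤ) :
    S.wr v k * S.wr S.p (k - 1) - S.wr v (k - 1) * S.wr S.p k = -(S.u k * S.det v k) := by
  simp only [det, wr]
  rw [show k - 1 + 1 = k by ring]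
  ring

lemma det_single (e k : ℤ) : S.det (Pi.single e 1) k =
    (if k = e - 1 then -S.wr S.p (e - 2) else 0) +
    (if k = e then S.u (e - 1) * S.p (e + 1) - S.u (e + 1) * S.p (e - 1) else 0) +
    (if k = e + 1 then -S.wr S.p (e + 1) else 0) := by
  simp only [det, Pi.single_apply]
  rcases eq_or_ne k (e - 1) with rfl | h1
  · have a2 : e - 1 ≠ e := by omega
    have a3 : e - 1 + 1 = e := by omega
    have a4 : e - 1 ≠ e + 1 := by omega
    have a5 : e - 1 - 1 = e - 2 := by omega
    simp [a2, a3, a4, a5]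
  rcases eq_or_ne k e with rfl | h2
  · simp [h1]
  rcases eq_or_ne k (e + 1) with rfl | h3
  · have a1 : e + 1 + 1 ≠ e := by omega
    simp [a1, h1]
  · have a1 : k - 1 ≠ e := by omega
    have a2 : k + 1 ≠ e := by omega
    simp [a1, a2, h1, h2, h3]

/-- This identity explains the choice of `coeff`: a unit mass at `e` meets `det` only at `e - 1`,
`e`, `e + 1`, and the weights combine the three terms into two differences of `det`, that is, into
the streams at the two endpoints of the edge. -/
lemma sum_coeff_det_single (v : ℤ → ℝ) {e : ℤ} (h0 : 1 ≤ e) (h1 : e ≤ N) :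
    ∑ k ∈ Finset.Icc (0 : ℤ) (N + 1), S.coeff k * (S.det v k * S.det (Pi.single e 1) k) =
      S.u (e + 1) * streamForm α v e - S.u (e - 1) * streamForm α v (e - 1) := by
  simp only [det_single, mul_add, Finset.sum_add_distrib, mul_ite, mul_zero, Finset.sum_ite_eq',
    Finset.mem_Icc]
  rw [if_pos (by omega), if_pos (by omega), if_pos (by omega)]
  have p1 := S.wr_pos (e := e) (by omega) (by omega)
  have p2 := S.wr_pos (e := e - 1) (by omega) (by omega)
  have k1 := S.streamForm_wr_eq v e
  have k2 := S.streamForm_wr_eq v (e - 1)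
  rw [show e - 1 + 1 = e by ring] at k2
  have k1' : streamForm α v e = α * (S.det v e - S.det v (e + 1)) / S.wr S.p e := by
    rw [← k1]; field_simp
  have k2' : streamForm α v (e - 1) = α * (S.det v (e - 1) - S.det v e) / S.wr S.p (e - 1) := by
    rw [← k2]; field_simp
  rw [k1', k2']
  have c1 : S.coeff (e - 1) * (S.det v (e - 1) * -S.wr S.p (e - 2)) =
      -(α * S.u (e - 1) * S.det v (e - 1) / S.wr S.p (e - 1)) := by
    unfold coeff
    rw [show e - 1 - 1 = e - 2 by ring]
    -- For `e = 1` the Wronskian at `-1` is not known to be nonzero; the weight at `0` vanishes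
    -- anyway, since `u 0 = 0`.
    rcases h0.eq_or_lt with h | h
    · rw [← h]; simp [S.u_zero]
    · have p3 := S.wr_pos (e := e - 2) (by omega) (by omega)
      field_simp
  have c2 : S.coeff (e + 1) * (S.det v (e + 1) * -S.wr S.p (e + 1)) =
      -(α * S.u (e + 1) * S.det v (e + 1) / S.wr S.p e) := by
    unfold coeff
    rw [show e + 1 - 1 = e by ring]
    rcases h1.eq_or_lt with h | h
    · rw [h]; simp [S.u_end]
    · have p3 := S.wr_pos (e := e + 1) (by omega) (by omega)
      field_simp
  have c3 : S.coeff e * (S.det v e * (S.u (e - 1) * S.p (e + 1) - S.u (e + 1) * S.p (e - 1))) =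
      α * S.det v e * (S.u (e + 1) / S.wr S.p e + S.u (e - 1) / S.wr S.p (e - 1)) := by
    have : S.u e * (S.u (e - 1) * S.p (e + 1) - S.u (e + 1) * S.p (e - 1)) =
        S.u (e + 1) * S.wr S.p (e - 1) + S.u (e - 1) * S.wr S.p e := by
      simp only [wr]; rw [show e - 1 + 1 = e by ring]; ring
    unfold coeff
    field_simp
    linear_combination α * S.det v e * this
  rw [c1, c2, c3]
  ring

lemma energy_add_single (v : ℤ → ℝ) {e : ℤ} (h0 : 1 ≤ e) (h1 : e ≤ N) :
    S.energy (v + Pi.single e 1) = S.energy v +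
      2 * (S.u (e + 1) * streamForm α v e - S.u (e - 1) * streamForm α v (e - 1)) +
      S.energy (Pi.single e 1) := by
  rw [← S.sum_coeff_det_single v h0 h1]
  simp only [energy, det_add, Finset.mul_sum, ← Finset.sum_add_distrib]
  exact Finset.sum_congr rfl fun k _ => by ring

/-! ### Coercivity -/

/-- A functional controlled by the square root of the energy on profiles vanishing at `0` and
`N + 1`. -/
def Controlled (φ : (ℤ → ℝ) → ℝ) : Prop :=
  ∃ C, 0 ≤ C ∧ ∀ v : ℤ → ℝ, v 0 = 0 → v (N + 1) = 0 → φ v ^ 2 ≤ C * S.energy v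

variable {S}

lemma Controlled.congr {φ ψ : (ℤ → ℝ) → ℝ} (h : S.Controlled φ)
    (e : ∀ v : ℤ → ℝ, v 0 = 0 → v (N + 1) = 0 → ψ v = φ v) : S.Controlled ψ := by
  obtain ⟨C, hC, H⟩ := h
  exact ⟨C, hC, fun v h0 h1 => by rw [e v h0 h1]; exact H v h0 h1⟩

lemma Controlled.add {φ ψ : (ℤ → ℝ) → ℝ} (h : S.Controlled φ) (h' : S.Controlled ψ) :
    S.Controlled fun v => φ v + ψ v := by
  obtain ⟨C, hC, H⟩ := h
  obtain ⟨C', hC', H'⟩ := h'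
  refine ⟨2 * C + 2 * C', by positivity, fun v h0 h1 => ?_⟩
  have := H v h0 h1
  have := H' v h0 h1
  nlinarith [sq_nonneg (φ v - ψ v)]

lemma Controlled.const_mul {φ : (ℤ → ℝ) → ℝ} (c : ℝ) (h : S.Controlled φ) :
    S.Controlled fun v => c * φ v := by
  obtain ⟨C, hC, H⟩ := h
  refine ⟨c ^ 2 * C, by positivity, fun v h0 h1 => ?_⟩
  have := mul_le_mul_of_nonneg_left (H v h0 h1) (sq_nonneg c)
  calc (c * φ v) ^ 2 = c ^ 2 * φ v ^ 2 := by ring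
    _ ≤ c ^ 2 * (C * S.energy v) := this
    _ = _ := by ring

lemma Controlled.sum {ι : Type*} (s : Finset ι) {φ : ι → (ℤ → ℝ) → ℝ}
    (h : ∀ i ∈ s, S.Controlled (φ i)) : S.Controlled fun v => ∑ i ∈ s, φ i v := by
  classical
  induction s using Finset.induction_on with
  | empty => exact ⟨0, le_rfl, fun v _ _ => by simp⟩
  | insert a s ha ih =>
    refine ((h a (Finset.mem_insert_self a s)).add
      (ih fun i hi => h i (Finset.mem_insert_of_mem hi))).congr fun v _ _ => ?_
    rw [Finset.sum_insert ha]

variable (S)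

lemma controlled_det (hα : 0 < α) {k : ℤ} (h0 : 1 ≤ k) (h1 : k ≤ N) :
    S.Controlled fun v => S.det v k := by
  have hc := S.coeff_pos hα h0 h1
  refine ⟨(S.coeff k)⁻¹, by positivity, fun v _ _ => ?_⟩
  have := S.coeff_mul_det_sq_le hα v (k := k) (by omega) (by omega)
  rw [inv_mul_eq_div, le_div_iff₀ hc]
  linarith

/-- Induction from the left end, where the Wronskian is zero because `u` and `v` both vanish at `0`;
`wr_wr` gives each next value from the previous one and a controlled determinant. -/
lemma controlled_wr (hα : 0 < α) (n : ℕ) (h1 : n ≤ N) : S.Controlled fun v => S.wr v n := by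
  induction n with
  | zero =>
    refine ⟨0, le_rfl, fun v h0 _ => ?_⟩
    simp [wr, S.u_zero, h0]
  | succ n ih =>
    have p := S.wr_pos (e := n) (by omega) (by omega)
    refine (((ih (by omega)).const_mul (S.wr S.p (n + 1) / S.wr S.p n)).add
      ((S.controlled_det hα (k := n + 1) (by omega) (by omega)).const_mul
        (-S.u (n + 1) / S.wr S.p n))).congr fun v _ _ => ?_
    have := S.wr_wr v (n + 1)
    rw [show (n : ℤ) + 1 - 1 = n by ring] at this
    push_cast
    field_simp
    linarith

/-- A small Wronskian at `n` means that `v` and `u` are nearly proportional on the edges `n` and `n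
+ 1`, so proportionality spreads from edge `1` to all others. -/
lemma controlled_cross_one (hα : 0 < α) (n : ℕ) (h1 : n ≤ N + 1) :
    S.Controlled fun v => v n * S.u 1 - S.u n * v 1 := by
  induction n with
  | zero => exact ⟨0, le_rfl, fun v h0 _ => by simp [S.u_zero, h0]⟩
  | succ n ih =>
    rcases Nat.eq_zero_or_pos n with rfl | hn
    · exact ⟨0, le_rfl, fun v h0 _ => by simp [mul_comm]⟩
    have p := S.u_pos n (by omega) (by omega)
    refine (((ih (by omega)).const_mul (S.u (n + 1) / S.u n)).add
      ((S.controlled_wr hα n (by omega)).const_mul (S.u 1 / S.u n))).congr fun v _ _ => ?_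
    simp only [wr]
    push_cast
    field_simp
    ring

/-- Summing over all reference edges replaces edge `1` by the total local time, which is known
exactly for a confined path. -/
lemma controlled_cross (hα : 0 < α) (hN : 1 ≤ N) (n : ℕ) (h1 : n ≤ N + 1) :
    S.Controlled fun v => v n * (∑ f ∈ Finset.Icc (1 : ℤ) N, S.u f) -
      S.u n * ∑ f ∈ Finset.Icc (1 : ℤ) N, v f := by
  have p := S.u_pos 1 le_rfl (by omega)
  have key : ∀ f ∈ Finset.Icc (1 : ℤ) N, S.Controlled fun v => v n * S.u f - S.u n * v f := by
    intro f hf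
    rw [Finset.mem_Icc] at hf
    lift f to ℕ using by omega
    refine (((S.controlled_cross_one hα n h1).const_mul (S.u f / S.u 1)).add
      ((S.controlled_cross_one hα f (by omega)).const_mul (-S.u n / S.u 1))).congr fun v _ _ => ?_
    field_simp
    ring
  refine (Controlled.sum _ key).congr fun v _ _ => ?_
  rw [Finset.mul_sum, Finset.mul_sum, ← Finset.sum_sub_distrib]

/-- At the left end the stream is asymptotically proportional to the total local time. -/
lemma controlled_left (hα : 0 < α) (hN : 1 ≤ N) :
    S.Controlled fun v => (-v 1 + α * v 2) * (∑ f ∈ Finset.Icc (1 : ℤ) N, S.u f) -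
      α * S.u (-1) * ∑ f ∈ Finset.Icc (1 : ℤ) N, v f := by
  refine (((S.controlled_cross hα hN 1 (by omega)).const_mul (-1)).add
    ((S.controlled_cross hα hN 2 (by omega)).const_mul α)).congr fun v _ _ => ?_
  -- As `u 0 = 0`, the recursion at `0` reads `α u (-1) = -u 1 + α u 2`: the value of `u` beyond the
  -- end encodes the end stream of the inner profile.
  have := S.u_stream 0
  simp only [streamForm, S.u_zero] at this
  norm_num at this ⊢
  linear_combination (∑ f ∈ Finset.Icc (1 : ℤ) N, v f) * this

/-- At the right end the stream is asymptotically proportional to the total local time. -/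
lemma controlled_right (hα : 0 < α) (hN : 1 ≤ N) :
    S.Controlled fun v => (-v N + α * v (N - 1)) * (∑ f ∈ Finset.Icc (1 : ℤ) N, S.u f) -
      α * S.u (N + 2) * ∑ f ∈ Finset.Icc (1 : ℤ) N, v f := by
  refine (((S.controlled_cross hα hN N (by omega)).const_mul (-1)).add
    ((S.controlled_cross hα hN (N - 1) (by omega)).const_mul α)).congr fun v _ _ => ?_
  have := S.u_stream N
  simp only [streamForm, S.u_end] at this
  push_cast [hN]
  linear_combination (-∑ f ∈ Finset.Icc (1 : ℤ) N, v f) * this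

/-! ### The Lyapunov function -/

/-- The correction attached to the site `y` when the walker is at `x` and the stream is `d`. -/
noncomputable def siteTerm (y x : ℤ) (d : ℝ) : ℝ :=
  if x < y then 2 * S.u (y + 1) * max d 0 else if y < x then 2 * S.u y * max (-d) 0 else 0

/-- The Lyapunov function of the confined walk. -/
noncomputable def lyapunov (v : ℤ → ℝ) (x : ℤ) : ℝ :=
  S.energy v + ∑ y ∈ Finset.Icc (0 : ℤ) N, S.siteTerm y x (streamForm α v y)

lemma siteTerm_nonneg {y x : ℤ} (h0 : 0 ≤ y) (h1 : y ≤ N) (d : ℝ) : 0 ≤ S.siteTerm y x d := by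
  have a := S.u_nonneg (j := y) (by omega) (by omega)
  have b := S.u_nonneg (j := y + 1) (by omega) (by omega)
  unfold siteTerm
  split_ifs
  · exact mul_nonneg (by linarith) (le_max_right _ _)
  · exact mul_nonneg (by linarith) (le_max_right _ _)
  · exact le_rfl

lemma energy_le_lyapunov (v : ℤ → ℝ) (x : ℤ) : S.energy v ≤ S.lyapunov v x := by
  refine le_add_of_nonneg_right (Finset.sum_nonneg fun y hy => ?_)
  rw [Finset.mem_Icc] at hy
  exact S.siteTerm_nonneg hy.1 hy.2 _

/-- An upper bound for the profile. -/
noncomputable def uMax : ℝ := ∑ j ∈ Finset.Icc (0 : ℤ) (N + 1), S.u j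

lemma u_le_uMax {j : ℤ} (h0 : 0 ≤ j) (h1 : j ≤ N + 1) : S.u j ≤ S.uMax := by
  refine Finset.single_le_sum (f := S.u) (fun k hk => ?_) (Finset.mem_Icc.2 ⟨h0, h1⟩)
  rw [Finset.mem_Icc] at hk
  exact S.u_nonneg hk.1 hk.2

lemma uMax_nonneg : 0 ≤ S.uMax := (S.u_nonneg le_rfl (by omega)).trans
  (S.u_le_uMax (j := 0) le_rfl (by omega))

/-- A bound for the bounded part of the increments of the Lyapunov function. -/
noncomputable def stepBound : ℝ :=
  (N + 1) * (2 * S.uMax * (1 + |α|)) + ∑ e ∈ Finset.Icc (1 : ℤ) N, |S.energy (Pi.single e 1)|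

lemma stepBound_nonneg : 0 ≤ S.stepBound := by
  have := S.uMax_nonneg
  unfold stepBound
  positivity

lemma streamForm_add (v w : ℤ → ℝ) (y : ℤ) :
    streamForm α (v + w) y = streamForm α v y + streamForm α w y := by
  simp only [streamForm, Pi.add_apply]; ring

lemma abs_streamForm_single_le (e y : ℤ) : |streamForm α (Pi.single e 1) y| ≤ 1 + |α| := by
  have h := abs_nonneg α
  simp only [streamForm, Pi.single_apply]
  split_ifs <;> first | omega | skip
  all_goals norm_num
  all_goals linarith

lemma energy_single_le {e : ℤ} (h0 : 1 ≤ e) (h1 : e ≤ N) :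
    S.energy (Pi.single e 1) ≤ ∑ e ∈ Finset.Icc (1 : ℤ) N, |S.energy (Pi.single e 1)| :=
  (le_abs_self _).trans <| Finset.single_le_sum
    (f := fun e : ℤ => |S.energy (Pi.single e 1)|) (fun _ _ => abs_nonneg _)
    (Finset.mem_Icc.2 ⟨h0, h1⟩)

lemma two_mul_max_le {a U c d d' : ℝ} (ha : 0 ≤ a) (haU : a ≤ U) (hc : 0 ≤ c) (h : d' ≤ d + c) :
    2 * a * max d' 0 ≤ 2 * a * max d 0 + 2 * U * c := by
  have h1 : max d' 0 ≤ max d 0 + c :=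
    max_le (h.trans (by linarith [le_max_left d 0])) (by linarith [le_max_right d 0])
  nlinarith [mul_le_mul_of_nonneg_left h1 ha, mul_le_mul_of_nonneg_right haU hc]

/-- The correction at `y` prepays the positive part of the energy change at the next entry into `y`:
entering from the left crosses edge `y` and contributes `2 u (y+1) s_y`, entering from the right
crosses edge `y + 1` and contributes `-2 u y s_y`. A step releases the term of the arrival site and
creates one at the departure site; elsewhere only the bounded change of the stream matters. -/
lemma siteTerm_step {x x' y : ℤ} (hx : x' = x + 1 ∨ x' = x - 1) (h0 : 0 ≤ y) (h1 : y ≤ N)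
    {d d' c : ℝ} (hc : 0 ≤ c) (hd : |d' - d| ≤ c) :
    S.siteTerm y x' d' ≤ S.siteTerm y x d + 2 * S.uMax * c +
      (if y = x then (if x' = x + 1 then 2 * S.u y * max (-d) 0
        else 2 * S.u (y + 1) * max d 0) else 0) -
      (if y = x' then (if x' = x + 1 then 2 * S.u (y + 1) * max d 0
        else 2 * S.u y * max (-d) 0) else 0) := by
  have a := S.u_nonneg (j := y) (by omega) (by omega)
  have b := S.u_nonneg (j := y + 1) (by omega) (by omega)
  have a' := S.u_le_uMax (j := y) (by omega) (by omega)
  have b' := S.u_le_uMax (j := y + 1) (by omega) (by omega)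
  have hU : 0 ≤ 2 * S.uMax * c := by have := S.uMax_nonneg; positivity
  have hd' := abs_le.1 hd
  have e1 := two_mul_max_le (d := d) (d' := d') b b' hc (by linarith)
  have e2 := two_mul_max_le (d := -d) (d' := -d') a a' hc (by linarith)
  unfold siteTerm
  rcases hx with rfl | rfl
  · simp only [if_true]
    rcases lt_trichotomy x y with h | h | h
    · rcases (show x + 1 ≤ y by omega).lt_or_eq with h' | h'
      · simp only [h, h', if_true, if_neg h.ne', if_neg h'.ne']; linarith
      · simp only [h, h', if_true, if_neg h.ne', lt_irrefl, if_false]; linarith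
    · subst h
      have : ¬ (x + 1 < x) := by omega
      have h3 : x ≠ x + 1 := by omega
      simp only [this, if_false, lt_irrefl, if_true, lt_add_iff_pos_right, zero_lt_one, if_neg h3]
      linarith
    · have h1 : ¬ (x + 1 < y) := by omega
      have h2 : y < x + 1 := by omega
      have h3 : ¬ (x < y) := by omega
      simp only [h1, h2, h3, h, if_false, if_true, if_neg h.ne, if_neg h2.ne]; linarith
  · have hne : x - 1 ≠ x + 1 := by omega
    simp only [if_neg hne]
    rcases lt_trichotomy y x with h | h | h
    · have h3 : ¬ (x < y) := by omega
      rcases (show y ≤ x - 1 by omega).lt_or_eq with h' | h'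
      · have h4 : ¬ (x - 1 < y) := by omega
        simp only [h, h', h3, h4, if_true, if_false, if_neg h.ne, if_neg h'.ne]; linarith
      · simp only [h, h3, ← h', if_true, if_neg h.ne, lt_irrefl, if_false]; linarith
    · subst h
      have h3 : y ≠ y - 1 := by omega
      simp only [if_false, lt_irrefl, if_true, if_neg h3, sub_lt_self_iff, zero_lt_one]
      linarith
    · have h1 : x - 1 < y := by omega
      simp only [h1, h, if_true, if_neg h.ne', if_neg h1.ne']; linarith

/-- The correction released at `x + 1` absorbs the energy gain there. The factor `4` is twice `2`:
once from the energy change at `x`, once from the correction created at `x`. The last term is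
positive only for a step against the stream. -/
lemma lyapunov_right_le (v : ℤ → ℝ) {x : ℤ} (h0 : 0 ≤ x) (h1 : x + 1 ≤ N) :
    S.lyapunov (v + Pi.single (x + 1) 1) (x + 1) ≤
      S.lyapunov v x + S.stepBound + 4 * S.u x * max (-streamForm α v x) 0 := by
  have hc : 0 ≤ 1 + |α| := by positivity
  have hs : ∑ y ∈ Finset.Icc (0 : ℤ) N, S.siteTerm y (x + 1)
        (streamForm α (v + Pi.single (x + 1) 1) y) ≤
      ∑ y ∈ Finset.Icc (0 : ℤ) N, (S.siteTerm y x (streamForm α v y) + 2 * S.uMax * (1 + |α|) +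
      (if y = x then 2 * S.u y * max (-streamForm α v y) 0 else 0) -
      (if y = x + 1 then 2 * S.u (y + 1) * max (streamForm α v y) 0 else 0)) := by
    refine Finset.sum_le_sum fun y hy => ?_
    rw [Finset.mem_Icc] at hy
    have := S.siteTerm_step (x := x) (x' := x + 1) (Or.inl rfl) hy.1 hy.2 hc
      (d := streamForm α v y) (d' := streamForm α (v + Pi.single (x + 1) 1) y)
      (by rw [streamForm_add, add_sub_cancel_left]; exact abs_streamForm_single_le _ _)
    simpa using this
  rw [Finset.sum_sub_distrib, Finset.sum_add_distrib, Finset.sum_add_distrib,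
    Finset.sum_ite_eq', Finset.sum_ite_eq', if_pos (Finset.mem_Icc.2 ⟨by omega, by omega⟩),
    if_pos (Finset.mem_Icc.2 ⟨by omega, by omega⟩), Finset.sum_const, Int.card_Icc,
    nsmul_eq_mul] at hs
  have hcard : (((N : ℤ) + 1 - 0).toNat : ℝ) = N + 1 := by
    rw [show ((N : ℤ) + 1 - 0).toNat = N + 1 by omega]; push_cast; ring
  rw [hcard] at hs
  have he := S.energy_add_single v (e := x + 1) (by omega) (by omega)
  rw [show x + 1 - 1 = x by ring] at he
  have hes := S.energy_single_le (e := x + 1) (by omega) (by omega)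
  have ux := S.u_nonneg (j := x) (by omega) (by omega)
  have ux2 := S.u_nonneg (j := x + 1 + 1) (by omega) (by omega)
  have m1 := mul_le_mul_of_nonneg_left (le_max_left (streamForm α v (x + 1)) 0) ux2
  have m2 := mul_le_mul_of_nonneg_left (le_max_left (-streamForm α v x) 0) ux
  unfold lyapunov stepBound
  rw [he]
  linarith

lemma lyapunov_left_le (v : ℤ → ℝ) {x : ℤ} (h0 : 1 ≤ x) (h1 : x ≤ N) :
    S.lyapunov (v + Pi.single x 1) (x - 1) ≤
      S.lyapunov v x + S.stepBound + 4 * S.u (x + 1) * max (streamForm α v x) 0 := by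
  have hc : 0 ≤ 1 + |α| := by positivity
  have hs : ∑ y ∈ Finset.Icc (0 : ℤ) N, S.siteTerm y (x - 1)
        (streamForm α (v + Pi.single x 1) y) ≤
      ∑ y ∈ Finset.Icc (0 : ℤ) N, (S.siteTerm y x (streamForm α v y) + 2 * S.uMax * (1 + |α|) +
      (if y = x then 2 * S.u (y + 1) * max (streamForm α v y) 0 else 0) -
      (if y = x - 1 then 2 * S.u y * max (-streamForm α v y) 0 else 0)) := by
    refine Finset.sum_le_sum fun y hy => ?_
    rw [Finset.mem_Icc] at hy
    have := S.siteTerm_step (x := x) (x' := x - 1) (Or.inr rfl) hy.1 hy.2 hc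
      (d := streamForm α v y) (d' := streamForm α (v + Pi.single x 1) y)
      (by rw [streamForm_add, add_sub_cancel_left]; exact abs_streamForm_single_le _ _)
    have hne : x - 1 ≠ x + 1 := by omega
    simpa only [if_neg hne] using this
  rw [Finset.sum_sub_distrib, Finset.sum_add_distrib, Finset.sum_add_distrib,
    Finset.sum_ite_eq', Finset.sum_ite_eq', if_pos (Finset.mem_Icc.2 ⟨by omega, by omega⟩),
    if_pos (Finset.mem_Icc.2 ⟨by omega, by omega⟩), Finset.sum_const, Int.card_Icc,
    nsmul_eq_mul] at hs
  have hcard : (((N : ℤ) + 1 - 0).toNat : ℝ) = N + 1 := by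
    rw [show ((N : ℤ) + 1 - 0).toNat = N + 1 by omega]; push_cast; ring
  rw [hcard] at hs
  have he := S.energy_add_single v (e := x) (by omega) (by omega)
  have hes := S.energy_single_le (e := x) (by omega) (by omega)
  have ux := S.u_nonneg (j := x - 1) (by omega) (by omega)
  have ux2 := S.u_nonneg (j := x + 1) (by omega) (by omega)
  have m1 := mul_le_mul_of_nonneg_left (le_max_left (-streamForm α v (x - 1)) 0) ux
  have m2 := mul_le_mul_of_nonneg_left (le_max_left (streamForm α v x) 0) ux2
  unfold lyapunov stepBound
  rw [he]
  linarith

end StreamProfile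

/-! ### Explicit profiles -/

/-- The recursion is antisymmetric about the midpoint of `j` and `j + 1`; centred there, it compares
symmetric differences with steps `t` and `3t`. -/
lemma streamForm_eq_zero_of_shift {α : ℝ} {v : ℤ → ℝ} (f : ℝ → ℝ) (t c : ℝ)
    (hv : ∀ j, v j = f (2 * t * (j - c)))
    (hf : ∀ x, f (x + t) - f (x - t) = α * (f (x + 3 * t) - f (x - 3 * t))) (j : ℤ) :
    streamForm α v j = 0 := by
  have := hf (2 * t * (j - c) + t)
  simp only [streamForm, hv]
  push_cast
  rw [show 2 * t * ((j : ℝ) - 1 - c) = 2 * t * (j - c) + t - 3 * t by ring,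
    show 2 * t * ((j : ℝ) + 1 - c) = 2 * t * (j - c) + t + t by ring,
    show 2 * t * ((j : ℝ) + 2 - c) = 2 * t * (j - c) + t + 3 * t by ring]
  rw [show 2 * t * (j - c) + t - t = 2 * t * (j - c) by ring] at this
  linarith

lemma sin_three_mul_of_critical {α t : ℝ} (h : α * (1 + 2 * Real.cos (2 * t)) = 1) :
    α * Real.sin (3 * t) = Real.sin t := by
  rw [Real.sin_three_mul]
  rw [Real.cos_two_mul'] at h
  linear_combination Real.sin t * h + 2 * α * Real.sin t * (-1) * Real.sin_sq_add_cos_sq t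

/-- About the centre `c` of `[0, N + 1]`, `u` is the even solution vanishing at both ends and `p`
the odd one. The condition `X < π` keeps `u` positive between its zeros. -/
lemma exists_streamProfile_trig {α t : ℝ} {N : ℕ} (hN : 1 ≤ N) (ht : 0 < t)
    (h : α * (1 + 2 * Real.cos (2 * t)) = 1) (hX : t * (N + 1) < Real.pi) :
    ∃ S : StreamProfile α N,
      S.u (-1) = 2 * Real.sin (t * (N + 2)) * -Real.sin t ∧
      S.u (N + 2) = 2 * Real.sin (t * (N + 2)) * -Real.sin t := by
  have hN' : (1 : ℝ) ≤ N := by exact_mod_cast hN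
  set c : ℝ := (N + 1) / 2 with hc
  set X : ℝ := t * (N + 1) with hXd
  have hXc : 2 * t * c = X := by rw [hc, hXd]; ring
  have htX : 2 * t ≤ X := by nlinarith
  have hcos3 := sin_three_mul_of_critical h
  have hst : 0 < Real.sin t := Real.sin_pos_of_pos_of_lt_pi ht (by linarith)
  refine ⟨⟨fun j => Real.cos (2 * t * (j - c)) - Real.cos X, fun j => Real.sin (2 * t * (j - c)),
    ?_, ?_, ?_, ?_, ?_, ?_⟩, ?_, ?_⟩
  · refine streamForm_eq_zero_of_shift (fun x => Real.cos x - Real.cos X) t c (fun j => rfl) ?_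
    intro x
    simp only [Real.cos_add, Real.cos_sub]
    linear_combination 2 * Real.sin x * hcos3
  · refine streamForm_eq_zero_of_shift Real.sin t c (fun j => rfl) ?_
    intro x
    simp only [Real.sin_add, Real.sin_sub]
    linear_combination (-2) * Real.cos x * hcos3
  · simp only [Int.cast_zero]
    rw [show 2 * t * (0 - c) = -X by rw [← hXc]; ring, Real.cos_neg, sub_self]
  · push_cast
    rw [show 2 * t * ((N : ℝ) + 1 - c) = X by rw [hc, hXd]; ring, sub_self]
  · intro j h0 h1
    have h0' : (1 : ℝ) ≤ j := by exact_mod_cast h0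
    have h1' : (j : ℝ) ≤ N := by exact_mod_cast h1
    have habs : |2 * t * ((j : ℝ) - c)| < X := by
      rw [abs_lt, hXd, hc]; constructor <;> nlinarith
    have := Real.cos_lt_cos_of_nonneg_of_le_pi (abs_nonneg _) hX.le habs
    rw [Real.cos_abs] at this
    exact sub_pos.2 this
  · intro e h0 h1
    have h0' : (0 : ℝ) ≤ e := by exact_mod_cast h0
    have h1' : (e : ℝ) ≤ N := by exact_mod_cast h1
    push_cast
    set ψ := 2 * t * ((e : ℝ) - c) + t with hψ
    rw [show 2 * t * ((e : ℝ) - c) = ψ - t by rw [hψ]; ring,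
      show 2 * t * ((e : ℝ) + 1 - c) = ψ + t by rw [hψ]; ring]
    have habs : |ψ| ≤ X - t := by
      rw [abs_le, hψ, hXd, hc]; constructor <;> nlinarith
    -- The Wronskian equals `2 sin t (cos t - cos X cos ψ)`, which is affine in `cos ψ ∈ [cos (X -
    -- t), 1]`; it suffices to check the two extreme values.
    have k1 := Real.cos_le_cos_of_nonneg_of_le_pi (abs_nonneg _) (by linarith) habs
    rw [Real.cos_abs] at k1
    have k2 : Real.cos X < Real.cos t :=
      Real.cos_lt_cos_of_nonneg_of_le_pi ht.le hX.le (by linarith)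
    have k3 : Real.cos X * Real.cos (X - t) < Real.cos t := by
      have := Real.cos_sub X (X - t)
      rw [sub_sub_cancel] at this
      have s1 := Real.sin_pos_of_pos_of_lt_pi (x := X) (by linarith) hX
      have s2 := Real.sin_pos_of_pos_of_lt_pi (x := X - t) (by linarith) (by linarith)
      nlinarith [mul_pos s1 s2]
    have k4 : Real.cos X * Real.cos ψ < Real.cos t := by
      rcases le_total 0 (Real.cos X) with hs | hs
      · nlinarith [Real.cos_le_one ψ]
      · nlinarith
    have e1 : (Real.cos (ψ - t) - Real.cos X) * Real.sin (ψ + t) -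
        (Real.cos (ψ + t) - Real.cos X) * Real.sin (ψ - t) =
        2 * Real.sin t * (Real.cos t - Real.cos X * Real.cos ψ) := by
      simp only [Real.cos_add, Real.cos_sub, Real.sin_add, Real.sin_sub]
      linear_combination 2 * Real.sin t * Real.cos t * Real.sin_sq_add_cos_sq ψ
    rw [e1]
    have := sub_pos.2 k4
    positivity
  · simp only [Int.cast_neg, Int.cast_one]
    rw [show 2 * t * (-1 - c) = -(t * (N + 2) + t) by rw [hc]; ring, Real.cos_neg,
      show X = t * (N + 2) - t by rw [hXd]; ring, Real.cos_add, Real.cos_sub]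
    ring
  · push_cast
    rw [show 2 * t * ((N : ℝ) + 2 - c) = t * (N + 2) + t by rw [hc]; ring,
      show X = t * (N + 2) - t by rw [hXd]; ring, Real.cos_add, Real.cos_sub]
    ring

/-- At `α = 1/3` the three characteristic roots merge at `1`, so the solutions are the polynomials
of degree at most two. -/
lemma exists_streamProfile_third {N : ℕ} (hN : 1 ≤ N) : ∃ S : StreamProfile (1 / 3) N, S.u (-1) < 0 := by
  have hN' : (0 : ℝ) ≤ N := by positivity
  refine ⟨⟨fun j => j * (N + 1 - j), fun j => j - (N + 1) / 2, ?_, ?_, ?_, ?_, ?_, ?_⟩, ?_⟩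
  · intro j; simp only [streamForm]; push_cast; ring
  · intro j; simp only [streamForm]; push_cast; ring
  · simp
  · simp
  · intro j h0 h1
    have h0' : (1 : ℝ) ≤ j := by exact_mod_cast h0
    have h1' : (j : ℝ) ≤ N := by exact_mod_cast h1
    exact mul_pos (by linarith) (by linarith)
  · intro e h0 h1
    have h0' : (0 : ℝ) ≤ e := by exact_mod_cast h0
    have h1' : (e : ℝ) ≤ N := by exact_mod_cast h1
    push_cast
    have hN1 : (1 : ℝ) ≤ N := by exact_mod_cast hN
    nlinarith [sq_nonneg ((e : ℝ) - N / 2), mul_nonneg h0' (sub_nonneg.2 h1')]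
  · push_cast; nlinarith

/-- The angle is now imaginary. Since `cosh` is increasing away from `0`, `u` is negative beyond its
zeros whatever `N` is. -/
lemma exists_streamProfile_hyperbolic {α : ℝ} {N : ℕ} (hN : 1 ≤ N) (h0 : 0 < α) (h1 : α < 1 / 3) :
    ∃ S : StreamProfile α N, S.u (-1) < 0 := by
  have hN' : (1 : ℝ) ≤ N := by exact_mod_cast hN
  obtain ⟨t, ht, h⟩ : ∃ t : ℝ, 0 < t ∧ α * (1 + 2 * Real.cosh (2 * t)) = 1 := by
    have hb : 1 < (1 - α) / (2 * α) := by rw [lt_div_iff₀ (by positivity)]; linarith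
    refine ⟨Real.arcosh ((1 - α) / (2 * α)) / 2, by
      have := Real.arcosh_pos hb
      linarith, ?_⟩
    rw [mul_div_cancel₀ _ two_ne_zero, Real.cosh_arcosh hb.le]
    field_simp
    ring
  set c : ℝ := (N + 1) / 2 with hc
  set X : ℝ := t * (N + 1) with hXd
  have hXc : 2 * t * c = X := by rw [hc, hXd]; ring
  have htX : 2 * t ≤ X := by nlinarith
  have hsinh3 : α * Real.sinh (3 * t) = Real.sinh t := by
    rw [Real.sinh_three_mul]
    rw [Real.cosh_two_mul] at h
    linear_combination Real.sinh t * h - 2 * α * Real.sinh t * Real.cosh_sq_sub_sinh_sq t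
  have hst : 0 < Real.sinh t := Real.sinh_pos_iff.2 ht
  refine ⟨⟨fun j => Real.cosh X - Real.cosh (2 * t * (j - c)),
    fun j => Real.sinh (2 * t * (j - c)), ?_, ?_, ?_, ?_, ?_, ?_⟩, ?_⟩
  · refine streamForm_eq_zero_of_shift (fun x => Real.cosh X - Real.cosh x) t c (fun j => rfl) ?_
    intro x
    simp only [Real.cosh_add, Real.cosh_sub]
    linear_combination 2 * Real.sinh x * hsinh3
  · refine streamForm_eq_zero_of_shift Real.sinh t c (fun j => rfl) ?_
    intro x
    simp only [Real.sinh_add, Real.sinh_sub]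
    linear_combination (-2) * Real.cosh x * hsinh3
  · simp only [Int.cast_zero]
    rw [show 2 * t * (0 - c) = -X by rw [← hXc]; ring, Real.cosh_neg, sub_self]
  · push_cast
    rw [show 2 * t * ((N : ℝ) + 1 - c) = X by rw [hc, hXd]; ring, sub_self]
  · intro j h0 h1
    have h0' : (1 : ℝ) ≤ j := by exact_mod_cast h0
    have h1' : (j : ℝ) ≤ N := by exact_mod_cast h1
    refine sub_pos.2 (Real.cosh_lt_cosh.2 ?_)
    rw [abs_of_nonneg (a := X) (by linarith), abs_lt, hXd, hc]
    constructor <;> nlinarith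
  · intro e h0 h1
    push_cast
    set ψ := 2 * t * ((e : ℝ) - c) + t with hψ
    rw [show 2 * t * ((e : ℝ) - c) = ψ - t by rw [hψ]; ring,
      show 2 * t * ((e : ℝ) + 1 - c) = ψ + t by rw [hψ]; ring]
    have k2 : Real.cosh t < Real.cosh X := by
      rw [Real.cosh_lt_cosh, abs_of_pos ht, abs_of_nonneg (by linarith)]; linarith
    have k3 := Real.one_le_cosh ψ
    have k5 := Real.cosh_pos X
    have e1 : (Real.cosh X - Real.cosh (ψ - t)) * Real.sinh (ψ + t) -
        (Real.cosh X - Real.cosh (ψ + t)) * Real.sinh (ψ - t) =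
        2 * Real.sinh t * (Real.cosh X * Real.cosh ψ - Real.cosh t) := by
      simp only [Real.cosh_add, Real.cosh_sub, Real.sinh_add, Real.sinh_sub]
      linear_combination (-2) * Real.sinh t * Real.cosh t * Real.cosh_sq_sub_sinh_sq ψ
    rw [e1]
    exact mul_pos (by linarith) (by nlinarith)
  · refine sub_neg.2 (Real.cosh_lt_cosh.2 ?_)
    push_cast
    rw [show 2 * t * (-1 - c) = -(X + 2 * t) by rw [← hXc]; ring, abs_neg,
      abs_of_nonneg (by linarith), abs_of_nonneg (by linarith)]
    linarith

/-- The angle `2t` with `α (1 + 2 cos 2t) = 1`. -/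
lemma exists_critical_angle {α : ℝ} (hα : 1 / 3 < α) :
    ∃ t, 0 < t ∧ 2 * t < 2 * Real.pi / 3 ∧ α * (1 + 2 * Real.cos (2 * t)) = 1 := by
  have h0 : 0 < α := by linarith
  have hlo : -(1 / 2) < (1 - α) / (2 * α) := by rw [lt_div_iff₀ (by positivity)]; linarith
  have hhi : (1 - α) / (2 * α) < 1 := by rw [div_lt_iff₀ (by positivity)]; linarith
  have hc : Real.cos (2 * (Real.arccos ((1 - α) / (2 * α)) / 2)) = (1 - α) / (2 * α) := by
    rw [mul_div_cancel₀ _ two_ne_zero, Real.cos_arccos (by linarith) hhi.le]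
  refine ⟨Real.arccos ((1 - α) / (2 * α)) / 2, by
    have := Real.arccos_pos.2 hhi
    linarith, ?_, ?_⟩
  · by_contra! hcon
    have := Real.cos_le_cos_of_nonneg_of_le_pi (by positivity)
      (by rw [mul_div_cancel₀ _ two_ne_zero]; exact Real.arccos_le_pi _) hcon
    rw [hc, show 2 * Real.pi / 3 = Real.pi - Real.pi / 3 by ring, Real.cos_pi_sub,
      Real.cos_pi_div_three] at this
    linarith
  · rw [hc]; field_simp; ring

/-! ### Critical values in terms of the angle -/

lemma criticalAlpha_eq {L : ℕ} (hL : 2 ≤ L) : criticalAlpha L =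
    ((1 / (1 + 2 * Real.cos (2 * Real.pi / ((L : ℝ) + 2))) : ℝ) : EReal) := by
  rw [criticalAlpha, if_neg (by omega)]

lemma cos_critical_nonneg {L : ℕ} (hL : 2 ≤ L) : 0 ≤ Real.cos (2 * Real.pi / ((L : ℝ) + 2)) := by
  have : (2 : ℝ) ≤ L := by exact_mod_cast hL
  refine Real.cos_nonneg_of_neg_pi_div_two_le_of_le ?_ ?_
  · have : 0 ≤ 2 * Real.pi / ((L : ℝ) + 2) := by positivity
    linarith [Real.pi_pos]
  · rw [div_le_iff₀ (by positivity)]; nlinarith [Real.pi_pos]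

lemma lt_criticalAlpha_iff_angle {α t : ℝ} {L : ℕ} (hL : 1 ≤ L) (h0 : 0 < α) (ht : 0 < t)
    (ht' : 2 * t < 2 * Real.pi / 3) (h : α * (1 + 2 * Real.cos (2 * t)) = 1) :
    (α : EReal) < criticalAlpha L ↔ t * (L + 2) < Real.pi := by
  rcases hL.eq_or_lt with rfl | hL
  · simp only [criticalAlpha, le_refl, if_true, EReal.coe_lt_top, true_iff]
    push_cast; linarith
  have hLr : (2 : ℝ) ≤ L := by exact_mod_cast hL
  have hc := cos_critical_nonneg hL
  rw [criticalAlpha_eq hL, EReal.coe_lt_coe_iff, lt_div_iff₀ (by positivity)]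
  have hiff : α * (1 + 2 * Real.cos (2 * Real.pi / ((L : ℝ) + 2))) < 1 ↔
      Real.cos (2 * Real.pi / ((L : ℝ) + 2)) < Real.cos (2 * t) := by
    constructor <;> intro h' <;> nlinarith
  rw [hiff]
  have hle : 2 * Real.pi / ((L : ℝ) + 2) ≤ Real.pi := by
    rw [div_le_iff₀ (by positivity)]; nlinarith [Real.pi_pos]
  rw [Real.strictAntiOn_cos.lt_iff_gt ⟨by positivity, hle⟩
    ⟨by positivity, by linarith [Real.pi_pos]⟩, lt_div_iff₀ (by positivity)]
  constructor <;> intro h <;> linarith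

lemma criticalAlpha_lt_iff_angle {α t : ℝ} {L : ℕ} (hL : 2 ≤ L) (h0 : 0 < α) (ht : 0 < t)
    (ht' : 2 * t < 2 * Real.pi / 3) (h : α * (1 + 2 * Real.cos (2 * t)) = 1) :
    criticalAlpha L < (α : EReal) ↔ Real.pi < t * (L + 2) := by
  have hLr : (2 : ℝ) ≤ L := by exact_mod_cast hL
  have hc := cos_critical_nonneg hL
  rw [criticalAlpha_eq hL, EReal.coe_lt_coe_iff, div_lt_iff₀ (by positivity)]
  have hiff : 1 < α * (1 + 2 * Real.cos (2 * Real.pi / ((L : ℝ) + 2))) ↔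
      Real.cos (2 * t) < Real.cos (2 * Real.pi / ((L : ℝ) + 2)) := by
    constructor <;> intro h' <;> nlinarith
  rw [hiff]
  have hle : 2 * Real.pi / ((L : ℝ) + 2) ≤ Real.pi := by
    rw [div_le_iff₀ (by positivity)]; nlinarith [Real.pi_pos]
  rw [Real.strictAntiOn_cos.lt_iff_gt ⟨by positivity, by linarith [Real.pi_pos]⟩
    ⟨by positivity, hle⟩, div_lt_iff₀ (by positivity)]
  constructor <;> intro h <;> linarith

lemma third_lt_criticalAlpha {α : ℝ} (hα : α ≤ 1 / 3) {L : ℕ} (hL : 2 ≤ L) :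
    (α : EReal) < criticalAlpha L := by
  have hLr : (2 : ℝ) ≤ L := by exact_mod_cast hL
  have hc := cos_critical_nonneg hL
  rw [criticalAlpha_eq hL, EReal.coe_lt_coe_iff]
  refine hα.trans_lt (one_div_lt_one_div_of_lt (by positivity) ?_)
  have : Real.cos (2 * Real.pi / ((L : ℝ) + 2)) < Real.cos 0 := by
    refine Real.cos_lt_cos_of_nonneg_of_le_pi le_rfl ?_ (by positivity)
    rw [div_le_iff₀ (by positivity)]; nlinarith [Real.pi_pos]
  rw [Real.cos_zero] at this
  linarith

/-- Below the critical value the profile pushes the walk outwards. -/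
lemma exists_outward_profile {α : ℝ} {L N : ℕ} (hα : 0 < α) (hN : 1 ≤ N) (hNL : N ≤ L)
    (h : (α : EReal) < criticalAlpha L) : ∃ S : StreamProfile α N, S.u (-1) < 0 := by
  rcases lt_trichotomy α (1 / 3) with h3 | h3 | h3
  · exact exists_streamProfile_hyperbolic hN hα h3
  · rw [h3]; exact exists_streamProfile_third hN
  obtain ⟨t, ht, ht', hc⟩ := exists_critical_angle h3
  rw [lt_criticalAlpha_iff_angle (hN.trans hNL) hα ht ht' hc] at h
  have hNL' : (N : ℝ) ≤ L := by exact_mod_cast hNL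
  have h2 : t * (N + 2) < Real.pi := by nlinarith
  obtain ⟨S, hS, -⟩ := exists_streamProfile_trig hN ht hc (by nlinarith)
  refine ⟨S, ?_⟩
  have s1 := Real.sin_pos_of_pos_of_lt_pi (x := t * (N + 2)) (by positivity) h2
  have s2 := Real.sin_pos_of_pos_of_lt_pi (x := t) (by positivity) (by linarith [Real.pi_pos])
  rw [hS]
  nlinarith [mul_pos s1 s2]

/-- Between two critical values the profile pushes the walk inwards. -/
lemma exists_inward_profile {α : ℝ} {L : ℕ} (hL : 1 ≤ L)
    (h1 : criticalAlpha (L + 1) < (α : EReal)) (h2 : (α : EReal) < criticalAlpha L) :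
    0 < α ∧ ∃ S : StreamProfile α (L + 1), 0 < S.u (-1) ∧ 0 < S.u (L + 1 + 2) := by
  have h3 : 1 / 3 < α := by
    by_contra! hcon
    exact lt_asymm h1 (third_lt_criticalAlpha hcon (by omega))
  have hα : 0 < α := by linarith
  refine ⟨hα, ?_⟩
  obtain ⟨t, ht, ht', hc⟩ := exists_critical_angle h3
  rw [lt_criticalAlpha_iff_angle hL hα ht ht' hc] at h2
  rw [criticalAlpha_lt_iff_angle (by omega) hα ht ht' hc] at h1
  push_cast at h1
  obtain ⟨S, hS, hS'⟩ := exists_streamProfile_trig (N := L + 1) (by omega) ht hc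
    (by push_cast; linarith)
  refine ⟨S, ?_⟩
  have s1 : Real.sin (t * ((L + 1 : ℕ) + 2)) < 0 := by
    -- Here `π < t (L + 3) < 2π`: the lower bound is `h1`, the upper one follows from `t (L + 2) <
    -- π` and the smallness of `t`.
    rw [← Real.sin_sub_two_pi]
    push_cast
    exact Real.sin_neg_of_neg_of_neg_pi_lt (by linarith [Real.pi_pos]) (by linarith)
  have s2 := Real.sin_pos_of_pos_of_lt_pi (x := t) (by positivity) (by linarith [Real.pi_pos])
  have : 0 < 2 * Real.sin (t * ((L + 1 : ℕ) + 2)) * -Real.sin t := by nlinarith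
  push_cast at hS hS' this
  rw [hS, hS']
  exact ⟨this, this⟩

/-! ### Local times along a path -/

lemma localTime_congr {x y : ℕ → ℤ} {n : ℕ} (h : ∀ k ≤ n, x k = y k) (j : ℤ) :
    localTime x n j = localTime y n j := by
  unfold localTime
  congr 1
  refine Finset.filter_congr fun m hm => ?_
  rw [Finset.mem_Icc] at hm
  rw [h m hm.2, h (m - 1) (by omega)]

lemma localTime_zero (x : ℕ → ℤ) (j : ℤ) : localTime x 0 j = 0 := by simp [localTime]

lemma localTime_succ (x : ℕ → ℤ) (n : ℕ) (j : ℤ) : localTime x (n + 1) j =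
    localTime x n j + if ({x n, x (n + 1)} : Finset ℤ) = {j - 1, j} then 1 else 0 := by
  unfold localTime
  rw [← Finset.insert_Icc_right_eq_Icc_add_one (by omega), Finset.filter_insert]
  simp only [Nat.add_sub_cancel]
  split_ifs with h
  · rw [Finset.card_insert_of_notMem (by simp)]
  · rfl

lemma pair_eq_pair_iff {a b j : ℤ} : ({a, b} : Finset ℤ) = {j - 1, j} ↔
    (a = j - 1 ∧ b = j) ∨ (a = j ∧ b = j - 1) := by
  constructor
  · intro h
    have ha : a ∈ ({j - 1, j} : Finset ℤ) := h ▸ (by simp)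
    have hb : b ∈ ({j - 1, j} : Finset ℤ) := h ▸ (by simp)
    have hj : j ∈ ({a, b} : Finset ℤ) := h ▸ (by simp)
    have hj' : j - 1 ∈ ({a, b} : Finset ℤ) := h ▸ (by simp)
    simp only [Finset.mem_insert, Finset.mem_singleton] at *
    omega
  · rintro (⟨rfl, rfl⟩ | ⟨rfl, rfl⟩)
    · rfl
    · exact Finset.pair_comm _ _

lemma localTime_succ_right {x : ℕ → ℤ} {n : ℕ} (h : x (n + 1) = x n + 1) (j : ℤ) :
    localTime x (n + 1) j = localTime x n j + if j = x n + 1 then 1 else 0 := by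
  rw [localTime_succ]
  congr 1
  refine if_congr ?_ rfl rfl
  rw [pair_eq_pair_iff]; omega

lemma localTime_succ_left {x : ℕ → ℤ} {n : ℕ} (h : x (n + 1) = x n - 1) (j : ℤ) :
    localTime x (n + 1) j = localTime x n j + if j = x n then 1 else 0 := by
  rw [localTime_succ]
  congr 1
  refine if_congr ?_ rfl rfl
  rw [pair_eq_pair_iff]; omega

lemma localTime_le (x : ℕ → ℤ) (n : ℕ) (j : ℤ) : localTime x n j ≤ n := by
  induction n with
  | zero => simp [localTime_zero]
  | succ n ih => rw [localTime_succ]; split_ifs <;> omega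

lemma localTime_mono (x : ℕ → ℤ) (j : ℤ) : Monotone fun n => localTime x n j :=
  monotone_nat_of_le_succ fun n => by rw [localTime_succ]; omega

lemma localTime_add_le (x : ℕ → ℤ) (n m : ℕ) (j : ℤ) :
    localTime x (n + m) j ≤ localTime x n j + m := by
  induction m with
  | zero => simp
  | succ m ih => rw [← add_assoc, localTime_succ]; split_ifs <;> omega

lemma localTime_eq_of_frozen {x : ℕ → ℤ} {n₀ : ℕ} {j : ℤ} {n : ℕ} (hn : n₀ ≤ n)
    (h : (∀ k, n₀ ≤ k → k ≤ n → x k ≠ j) ∨ (∀ k, n₀ ≤ k → k ≤ n → x k ≠ j - 1)) :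
    localTime x n j = localTime x n₀ j := by
  induction n, hn using Nat.le_induction with
  | base => rfl
  | succ n hn ih =>
    rw [localTime_succ, ih (h.imp (fun h k a b => h k a (by omega))
      fun h k a b => h k a (by omega)), if_neg, add_zero]
    rw [pair_eq_pair_iff]
    rcases h with h | h
    all_goals
      have := h n hn (by omega)
      have := h (n + 1) (by omega) le_rfl
      omega

lemma localStream_congr {x y : ℕ → ℤ} {n : ℕ} (α : ℝ) (h : ∀ k ≤ n, x k = y k) (j : ℤ) :
    localStream α x n j = localStream α y n j := by
  simp only [localStream, localTime_congr h]

lemma abs_localStream_le (α : ℝ) (x : ℕ → ℤ) (n : ℕ) (j : ℤ) :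
    |localStream α x n j| ≤ 2 * (1 + |α|) * n := by
  have hb : ∀ j, (localTime x n j : ℝ) ≤ n := fun j => by exact_mod_cast localTime_le x n j
  have h0 : ∀ j, (0 : ℝ) ≤ localTime x n j := fun j => by positivity
  have e : ∀ j, |α * (localTime x n j : ℝ)| ≤ |α| * n := fun j => by
    rw [abs_mul, abs_of_nonneg (h0 j)]
    exact mul_le_mul_of_nonneg_left (hb j) (abs_nonneg _)
  have a1 := abs_le.1 (e (j - 1))
  have a2 := abs_le.1 (e (j + 2))
  have := hb j
  have := hb (j + 1)
  have := h0 j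
  have := h0 (j + 1)
  unfold localStream
  rw [abs_le]
  constructor <;> nlinarith

lemma localStream_add_le (α : ℝ) (x : ℕ → ℤ) (n m : ℕ) (j : ℤ) :
    |localStream α x (n + m) j - localStream α x n j| ≤ 2 * (1 + |α|) * m := by
  have hb : ∀ j, (localTime x (n + m) j : ℝ) - localTime x n j ≤ m := fun j => by
    have := localTime_add_le x n m j
    rw [sub_le_iff_le_add']; exact_mod_cast this
  have h0 : ∀ j, (0 : ℝ) ≤ (localTime x (n + m) j : ℝ) - localTime x n j := fun j =>
    sub_nonneg.2 (by exact_mod_cast localTime_mono x j (Nat.le_add_right n m))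
  have e : ∀ j, |α * ((localTime x (n + m) j : ℝ) - localTime x n j)| ≤ |α| * m := fun j => by
    rw [abs_mul, abs_of_nonneg (h0 j)]
    exact mul_le_mul_of_nonneg_left (hb j) (abs_nonneg _)
  have a1 := abs_le.1 (e (j - 1))
  have a2 := abs_le.1 (e (j + 2))
  have := hb j
  have := hb (j + 1)
  have := h0 j
  have := h0 (j + 1)
  unfold localStream
  rw [abs_le]
  constructor <;> nlinarith

/-! ### One-step transitions -/

/-- The probability of a step to the right, given the path up to time `n`. -/
noncomputable def probRight (α β : ℝ) (n : ℕ) (x : ℕ → ℤ) : ℝ :=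
  Real.exp (β * localStream α x n (x n)) /
    (Real.exp (β * localStream α x n (x n)) + Real.exp (-(β * localStream α x n (x n))))

/-- The probability of a step to the left, given the path up to time `n`. -/
noncomputable def probLeft (α β : ℝ) (n : ℕ) (x : ℕ → ℤ) : ℝ :=
  Real.exp (-(β * localStream α x n (x n))) /
    (Real.exp (β * localStream α x n (x n)) + Real.exp (-(β * localStream α x n (x n))))

/-- The path that follows `x` until time `n` and then makes a step `d`. -/
def extendPath (x : ℕ → ℤ) (n : ℕ) (d : ℤ) : ℕ → ℤ := fun k => if k ≤ n then x k else x n + d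

lemma probRight_pos (α β : ℝ) (n : ℕ) (x : ℕ → ℤ) : 0 < probRight α β n x := by
  unfold probRight; positivity

lemma probLeft_pos (α β : ℝ) (n : ℕ) (x : ℕ → ℤ) : 0 < probLeft α β n x := by
  unfold probLeft; positivity

lemma probRight_add_probLeft (α β : ℝ) (n : ℕ) (x : ℕ → ℤ) :
    probRight α β n x + probLeft α β n x = 1 := by
  unfold probRight probLeft
  rw [← add_div, div_self (by positivity)]

lemma probRight_mul (α β : ℝ) (n : ℕ) (x : ℕ → ℤ) :
    probRight α β n x * (1 + Real.exp (-(2 * β * localStream α x n (x n)))) = 1 := by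
  unfold probRight
  rw [show -(2 * β * localStream α x n (x n)) =
    -(β * localStream α x n (x n)) - β * localStream α x n (x n) by ring, Real.exp_sub]
  field_simp

lemma probLeft_mul (α β : ℝ) (n : ℕ) (x : ℕ → ℤ) :
    probLeft α β n x * (1 + Real.exp (2 * β * localStream α x n (x n))) = 1 := by
  unfold probLeft
  rw [show 2 * β * localStream α x n (x n) =
    β * localStream α x n (x n) - -(β * localStream α x n (x n)) by ring, Real.exp_sub]
  field_simp
  ring

lemma dependsOn_probRight (α β : ℝ) (n : ℕ) : DependsOn (probRight α β n) (Set.Iic n) := by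
  intro x y h
  simp only [probRight, localStream_congr α (x := x) (y := y) fun k hk => h k hk,
    h n (Set.mem_Iic.2 le_rfl)]

lemma dependsOn_probLeft (α β : ℝ) (n : ℕ) : DependsOn (probLeft α β n) (Set.Iic n) := by
  intro x y h
  simp only [probLeft, localStream_congr α (x := x) (y := y) fun k hk => h k hk,
    h n (Set.mem_Iic.2 le_rfl)]

lemma dependsOn_extendPath {Z : (ℕ → ℤ) → ℝ} (n : ℕ) (d : ℤ) :
    DependsOn (fun x => Z (extendPath x n d)) (Set.Iic n) := by
  intro x y h
  have : extendPath x n d = extendPath y n d := by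
    funext k
    simp only [extendPath]
    split_ifs with hk
    · exact h k hk
    · rw [h n (Set.mem_Iic.2 le_rfl)]
  simp only [this]

lemma extendPath_of_le {x : ℕ → ℤ} {n k : ℕ} (d : ℤ) (h : k ≤ n) : extendPath x n d k = x k :=
  if_pos h

lemma extendPath_succ (x : ℕ → ℤ) (n : ℕ) (d : ℤ) : extendPath x n d (n + 1) = x n + d :=
  if_neg (by omega)

lemma DependsOn.extendPath_eq {Z : (ℕ → ℤ) → ℝ} {n : ℕ} (hZ : DependsOn Z (Set.Iic (n + 1)))
    {x : ℕ → ℤ} {d : ℤ} (h : x (n + 1) = x n + d) : Z (extendPath x n d) = Z x := by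
  refine hZ fun k hk => ?_
  rcases (Set.mem_Iic.1 hk).lt_or_eq with h' | rfl
  · exact extendPath_of_le d (by omega)
  · rw [extendPath_succ, h]

/-! ### Measurability, integrability and averaging over the last step -/

namespace IsPushedWalk

variable {α β : ℝ} {Ω : Type*} [mΩ : MeasurableSpace Ω] {P : Measure Ω} {X : ℕ → Ω → ℤ}

/-- The natural filtration of the walk. -/
noncomputable def filtration (hX : IsPushedWalk α β P X) : Filtration ℕ mΩ :=
  Filtration.natural X (fun k => (hX.measurable k).stronglyMeasurable)

/-- Finite integer paths form a countable discrete space, so every function of the path up to time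
`n` is measurable. -/
lemma measurable_of_dependsOn (hX : IsPushedWalk α β P X) {γ : Type*} [MeasurableSpace γ]
    [Nonempty γ] {Z : (ℕ → ℤ) → γ} {n : ℕ} (hZ : DependsOn Z (Set.Iic n)) :
    Measurable[hX.filtration n] fun ω => Z fun k => X k ω := by
  obtain ⟨g, hg⟩ := (dependsOn_iff_exists_comp).1 hZ
  rw [hg, filtration, Filtration.natural_eq_comap]
  have : Measurable g := Measurable.of_discrete
  exact this.comp (comap_measurable _)

lemma measurable_path (hX : IsPushedWalk α β P X) {γ : Type*} [MeasurableSpace γ]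
    [Nonempty γ] {Z : (ℕ → ℤ) → γ} {n : ℕ} (hZ : DependsOn Z (Set.Iic n)) :
    Measurable fun ω => Z fun k => X k ω :=
  (hX.measurable_of_dependsOn hZ).mono (hX.filtration.le n) le_rfl

lemma measurableSet_right (hX : IsPushedWalk α β P X) (n : ℕ) :
    MeasurableSet {ω | X (n + 1) ω = X n ω + 1} :=
  measurableSet_eq_fun (hX.measurable _) ((hX.measurable _).add_const 1)

lemma measurableSet_left (hX : IsPushedWalk α β P X) (n : ℕ) :
    MeasurableSet {ω | X (n + 1) ω = X n ω - 1} :=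
  measurableSet_eq_fun (hX.measurable _) ((hX.measurable _).sub_const 1)

lemma condExp_right (hX : IsPushedWalk α β P X) (n : ℕ) :
    P[{ω | X (n + 1) ω = X n ω + 1}.indicator (fun _ => (1 : ℝ)) | hX.filtration n] =ᵐ[P]
      fun ω => probRight α β n fun k => X k ω := hX.step_right n

lemma condExp_left (hX : IsPushedWalk α β P X) (n : ℕ) :
    P[{ω | X (n + 1) ω = X n ω - 1}.indicator (fun _ => (1 : ℝ)) | hX.filtration n] =ᵐ[P]
      fun ω => probLeft α β n fun k => X k ω := hX.step_left n

variable [IsProbabilityMeasure P]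

lemma integrable_of_mem_Icc (hX : IsPushedWalk α β P X) {Z : (ℕ → ℤ) → ℝ} {n : ℕ}
    (hZ : DependsOn Z (Set.Iic n)) (h0 : ∀ x, Z x ∈ Set.Icc (0 : ℝ) 1) :
    Integrable (fun ω => Z fun k => X k ω) P :=
  Integrable.of_bound (hX.measurable_path hZ).aestronglyMeasurable 1
    (Eventually.of_forall fun ω => by
      rw [Real.norm_of_nonneg (h0 _).1]; exact (h0 _).2)

lemma integrable_probRight (hX : IsPushedWalk α β P X) (n : ℕ) :
    Integrable (fun ω => probRight α β n fun k => X k ω) P :=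
  hX.integrable_of_mem_Icc (dependsOn_probRight α β n) fun x =>
    ⟨(probRight_pos α β n x).le, by
      linarith [probRight_add_probLeft α β n x, probLeft_pos α β n x]⟩

lemma integrable_probLeft (hX : IsPushedWalk α β P X) (n : ℕ) :
    Integrable (fun ω => probLeft α β n fun k => X k ω) P :=
  hX.integrable_of_mem_Icc (dependsOn_probLeft α β n) fun x =>
    ⟨(probLeft_pos α β n x).le, by
      linarith [probRight_add_probLeft α β n x, probRight_pos α β n x]⟩

lemma measureReal_right (hX : IsPushedWalk α β P X) (n : ℕ) :
    P.real {ω | X (n + 1) ω = X n ω + 1} = ∫ ω, probRight α β n (fun k => X k ω) ∂P := by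
  rw [← integral_congr_ae (hX.condExp_right n), integral_condExp (hX.filtration.le n)]
  exact (integral_indicator_one (hX.measurableSet_right n)).symm

lemma measureReal_left (hX : IsPushedWalk α β P X) (n : ℕ) :
    P.real {ω | X (n + 1) ω = X n ω - 1} = ∫ ω, probLeft α β n (fun k => X k ω) ∂P := by
  rw [← integral_congr_ae (hX.condExp_left n), integral_condExp (hX.filtration.le n)]
  exact (integral_indicator_one (hX.measurableSet_left n)).symm

/-- Almost surely the walk makes nearest-neighbour steps. -/
lemma ae_nearest_neighbour (hX : IsPushedWalk α β P X) :
    ∀ᵐ ω ∂P, ∀ n, X (n + 1) ω = X n ω + 1 ∨ X (n + 1) ω = X n ω - 1 := by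
  rw [ae_all_iff]
  intro n
  have hd : Disjoint {ω | X (n + 1) ω = X n ω + 1} {ω | X (n + 1) ω = X n ω - 1} := by
    rw [Set.disjoint_left]
    intro ω h1 h2
    simp only [Set.mem_ofPred_eq] at h1 h2
    omega
  have h1 := measureReal_union (μ := P) hd (hX.measurableSet_left n)
  rw [hX.measureReal_right, hX.measureReal_left,
    ← integral_add (hX.integrable_probRight n) (hX.integrable_probLeft n)] at h1
  simp only [probRight_add_probLeft, integral_const, probReal_univ, smul_eq_mul, mul_one] at h1
  have h2 : P ({ω | X (n + 1) ω = X n ω + 1} ∪ {ω | X (n + 1) ω = X n ω - 1}) = 1 := by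
    rw [measureReal_def] at h1
    rw [← ENNReal.ofReal_toReal (measure_ne_top P _), h1, ENNReal.ofReal_one]
  exact (prob_compl_eq_zero_iff
    ((hX.measurableSet_right n).union (hX.measurableSet_left n))).2 h2

lemma ae_abs_le (hX : IsPushedWalk α β P X) : ∀ᵐ ω ∂P, ∀ n : ℕ, |X n ω| ≤ n := by
  filter_upwards [hX.start, hX.ae_nearest_neighbour] with ω h0 h n
  induction n with
  | zero => simp [h0]
  | succ n ih =>
    rw [abs_le] at ih ⊢
    push_cast
    rcases h n with h | h <;> omega

/-- Almost surely `|X k| ≤ k`, so the path up to time `n` takes finitely many values and any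
functional of it is bounded. -/
lemma integrable (hX : IsPushedWalk α β P X) {Z : (ℕ → ℤ) → ℝ} {n : ℕ}
    (hZ : DependsOn Z (Set.Iic n)) : Integrable (fun ω => Z fun k => X k ω) P := by
  obtain ⟨g, hg⟩ := (dependsOn_iff_exists_comp).1 hZ
  have hfin : (Set.univ.pi fun _ : Set.Iic n => Set.Icc (-(n : ℤ)) n).Finite :=
    Set.Finite.pi fun _ => Set.finite_Icc _ _
  obtain ⟨B, hB⟩ := (hfin.image fun v => ‖g v‖).bddAbove
  refine Integrable.of_bound (hX.measurable_path hZ).aestronglyMeasurable B ?_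
  filter_upwards [hX.ae_abs_le] with ω hω
  rw [hg]
  refine hB ⟨_, fun k _ => ?_, rfl⟩
  have := abs_le.1 (hω k)
  have hk : (k : ℕ) ≤ n := k.2
  simp only [Set.domRestrict_apply, Set.mem_Icc]
  omega

lemma integral_right_mul (hX : IsPushedWalk α β P X) {Y : (ℕ → ℤ) → ℝ} {n : ℕ}
    (hY : DependsOn Y (Set.Iic n)) :
    ∫ ω, {ω | X (n + 1) ω = X n ω + 1}.indicator (fun _ => (1 : ℝ)) ω * Y (fun k => X k ω) ∂P =
      ∫ ω, probRight α β n (fun k => X k ω) * Y (fun k => X k ω) ∂P := by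
  have hm := hX.measurable_of_dependsOn hY
  have hi : Integrable ({ω | X (n + 1) ω = X n ω + 1}.indicator fun _ => (1 : ℝ)) P :=
    (integrable_const 1).indicator (hX.measurableSet_right n)
  have := condExp_mul_of_stronglyMeasurable_right (m := hX.filtration n) (μ := P)
    hm.stronglyMeasurable ((hX.integrable hY).indicator (hX.measurableSet_right n) |>.congr
      (Eventually.of_forall fun ω => by
        by_cases h : ω ∈ {ω | X (n + 1) ω = X n ω + 1} <;> simp [Set.indicator, h])) hi
  rw [← integral_condExp (hX.filtration.le n)]
  refine integral_congr_ae (this.trans ?_)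
  filter_upwards [hX.condExp_right n] with ω h
  simp only [Pi.mul_apply, h]

lemma integral_left_mul (hX : IsPushedWalk α β P X) {Y : (ℕ → ℤ) → ℝ} {n : ℕ}
    (hY : DependsOn Y (Set.Iic n)) :
    ∫ ω, {ω | X (n + 1) ω = X n ω - 1}.indicator (fun _ => (1 : ℝ)) ω * Y (fun k => X k ω) ∂P =
      ∫ ω, probLeft α β n (fun k => X k ω) * Y (fun k => X k ω) ∂P := by
  have hm := hX.measurable_of_dependsOn hY
  have hi : Integrable ({ω | X (n + 1) ω = X n ω - 1}.indicator fun _ => (1 : ℝ)) P :=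
    (integrable_const 1).indicator (hX.measurableSet_left n)
  have := condExp_mul_of_stronglyMeasurable_right (m := hX.filtration n) (μ := P)
    hm.stronglyMeasurable ((hX.integrable hY).indicator (hX.measurableSet_left n) |>.congr
      (Eventually.of_forall fun ω => by
        by_cases h : ω ∈ {ω | X (n + 1) ω = X n ω - 1} <;> simp [Set.indicator, h])) hi
  rw [← integral_condExp (hX.filtration.le n)]
  refine integral_congr_ae (this.trans ?_)
  filter_upwards [hX.condExp_left n] with ω h
  simp only [Pi.mul_apply, h]

/-- The one-step formula: averaging over the last step. -/
lemma integral_step (hX : IsPushedWalk α β P X) {Z : (ℕ → ℤ) → ℝ} {n : ℕ}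
    (hZ : DependsOn Z (Set.Iic (n + 1))) :
    ∫ ω, Z (fun k => X k ω) ∂P =
      ∫ ω, (probRight α β n (fun k => X k ω) * Z (extendPath (fun k => X k ω) n 1) +
        probLeft α β n (fun k => X k ω) * Z (extendPath (fun k => X k ω) n (-1))) ∂P := by
  have d1 := dependsOn_extendPath (Z := Z) n 1
  have d2 := dependsOn_extendPath (Z := Z) n (-1)
  have i1 : Integrable (fun ω => {ω | X (n + 1) ω = X n ω + 1}.indicator (fun _ => (1 : ℝ)) ω *
      Z (extendPath (fun k => X k ω) n 1)) P :=
    ((hX.integrable d1).indicator (hX.measurableSet_right n)).congr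
      (Eventually.of_forall fun ω => by
        by_cases h : ω ∈ {ω | X (n + 1) ω = X n ω + 1} <;> simp [Set.indicator, h])
  have i2 : Integrable (fun ω => {ω | X (n + 1) ω = X n ω - 1}.indicator (fun _ => (1 : ℝ)) ω *
      Z (extendPath (fun k => X k ω) n (-1))) P :=
    ((hX.integrable d2).indicator (hX.measurableSet_left n)).congr
      (Eventually.of_forall fun ω => by
        by_cases h : ω ∈ {ω | X (n + 1) ω = X n ω - 1} <;> simp [Set.indicator, h])
  have m1 : DependsOn (fun x => probRight α β n x * Z (extendPath x n 1)) (Set.Iic n) :=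
    fun x y h => by simp only [dependsOn_probRight α β n h, d1 h]
  have m2 : DependsOn (fun x => probLeft α β n x * Z (extendPath x n (-1))) (Set.Iic n) :=
    fun x y h => by simp only [dependsOn_probLeft α β n h, d2 h]
  rw [integral_add (hX.integrable m1) (hX.integrable m2), ← hX.integral_right_mul d1,
    ← hX.integral_left_mul d2]
  rw [← integral_add i1 i2]
  refine integral_congr_ae ?_
  filter_upwards [hX.ae_nearest_neighbour] with ω h
  rcases h n with h | h
  · have h' : ω ∉ {ω | X (n + 1) ω = X n ω - 1} := by
      simp only [Set.mem_ofPred_eq]; omega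
    have h'' : ω ∈ {ω | X (n + 1) ω = X n ω + 1} := h
    rw [Set.indicator_of_notMem h', Set.indicator_of_mem h'', one_mul, zero_mul, add_zero]
    exact (hZ.extendPath_eq (d := 1) (x := fun k => X k ω) h).symm
  · have h' : ω ∉ {ω | X (n + 1) ω = X n ω + 1} := by
      simp only [Set.mem_ofPred_eq]; omega
    have h'' : ω ∈ {ω | X (n + 1) ω = X n ω - 1} := h
    rw [Set.indicator_of_notMem h', Set.indicator_of_mem h'', one_mul, zero_mul, zero_add]
    exact (hZ.extendPath_eq (d := -1) (x := fun k => X k ω) h).symm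

end IsPushedWalk

/-! ### Conditional Borel–Cantelli for steps to the left -/

lemma tendsto_sum_atTop_of_frequently {f : ℕ → ℝ} (h0 : ∀ n, 0 ≤ f n) {ε : ℝ} (hε : 0 < ε)
    (h : ∃ᶠ n in atTop, ε ≤ f n) :
    Tendsto (fun n => ∑ k ∈ Finset.range n, f k) atTop atTop := by
  rw [← not_summable_iff_tendsto_nat_atTop_of_nonneg h0]
  intro hs
  exact h ((hs.tendsto_atTop_zero.eventually_lt_const hε).mono fun n hn => not_le.2 hn)

/-- If the walk visits `j` infinitely often while the stream stays bounded above there, then it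
also visits `j - 1` infinitely often. -/
lemma IsPushedWalk.ae_frequently_left {α β : ℝ} (hβ : 0 < β) {Ω : Type*} [mΩ : MeasurableSpace Ω]
    {P : Measure Ω} [IsProbabilityMeasure P] {X : ℕ → Ω → ℤ} (hX : IsPushedWalk α β P X) (j : ℤ) :
    ∀ᵐ ω ∂P, ∀ c : ℝ,
      (∃ᶠ n in atTop, X n ω = j ∧ localStream α (fun k => X k ω) n j ≤ c) →
      ∃ᶠ n in atTop, X n ω = j - 1 := by
  -- At `n = 0` the truncated subtraction makes this set empty.
  let s : ℕ → Set Ω := fun n => {ω | X (n - 1) ω = j ∧ X n ω = j - 1}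
  have hs : ∀ n, MeasurableSet[hX.filtration n] (s n) := by
    intro n
    have hd : DependsOn (fun x : ℕ → ℤ => (x (n - 1), x n)) (Set.Iic n) := by
      intro x y h
      simp only [h n (Set.mem_Iic.2 le_rfl), h (n - 1) (Set.mem_Iic.2 (Nat.sub_le n 1))]
    have he : s n = (fun ω => (X (n - 1) ω, X n ω)) ⁻¹' {(j, j - 1)} := by
      ext ω
      simp [s]
    rw [he]
    exact hX.measurable_of_dependsOn hd (measurableSet_singleton _)
  have hc : ∀ n, P[(s (n + 1)).indicator (1 : Ω → ℝ) | hX.filtration n] =ᵐ[P] fun ω =>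
      probLeft α β n (fun k => X k ω) * if X n ω = j then 1 else 0 := by
    intro n
    have hd : DependsOn (fun x : ℕ → ℤ => if x n = j then (1 : ℝ) else 0) (Set.Iic n) :=
      fun x y h => by simp only [h n (Set.mem_Iic.2 le_rfl)]
    have hi : Integrable ({ω | X (n + 1) ω = X n ω - 1}.indicator fun _ => (1 : ℝ)) P :=
      (integrable_const 1).indicator (hX.measurableSet_left n)
    have he : (s (n + 1)).indicator (1 : Ω → ℝ) =
        ({ω | X (n + 1) ω = X n ω - 1}.indicator fun _ => (1 : ℝ)) *
          fun ω => if X n ω = j then (1 : ℝ) else 0 := by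
      funext ω
      simp only [Set.indicator, Set.mem_ofPred_eq, Pi.one_apply, Pi.mul_apply, s,
        Nat.add_sub_cancel]
      by_cases h : X n ω = j <;> simp [h]
    have hi' : Integrable ((s (n + 1)).indicator (1 : Ω → ℝ)) P :=
      (integrable_const 1).indicator (hX.filtration.le _ _ (hs _))
    rw [he] at hi' ⊢
    refine (condExp_mul_of_stronglyMeasurable_right
      (hX.measurable_of_dependsOn hd).stronglyMeasurable hi' hi).trans ?_
    filter_upwards [hX.condExp_left n] with ω h
    simp only [Pi.mul_apply, h]
  -- Lévy's form of Borel–Cantelli. The null set is fixed before `c`, so quantifying over all real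
  -- `c` is harmless.
  filter_upwards [ae_mem_limsup_atTop_iff P hs, ae_all_iff.2 hc] with ω h1 h2 c h3
  have hfreq : ∃ᶠ n in atTop, ω ∈ s n := by
    rw [← mem_limsup_iff_frequently_mem, h1]
    simp only [h2]
    refine tendsto_sum_atTop_of_frequently
      (fun n => mul_nonneg (probLeft_pos _ _ _ _).le (by split_ifs <;> norm_num))
      (ε := (1 + Real.exp (2 * β * c))⁻¹) (by positivity) (h3.mono fun n hn => ?_)
    rw [if_pos hn.1, mul_one]
    have := probLeft_mul α β n fun k => X k ω
    rw [hn.1] at this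
    rw [eq_inv_of_mul_eq_one_left this]
    refine inv_anti₀ (by positivity) ?_
    gcongr
    exact hn.2
  exact hfreq.mono fun n hn => hn.2

/-! ### The walk weighted by staying in an interval -/

/-- The local times on the edges inside `[a, a + N]`, extended by `0`. -/
def edgeProfile (a : ℤ) (N : ℕ) (x : ℕ → ℤ) (n : ℕ) : ℤ → ℝ :=
  fun e => if 1 ≤ e ∧ e ≤ N then (localTime x n (a + e) : ℝ) else 0

lemma edgeProfile_congr (a : ℤ) (N : ℕ) {x y : ℕ → ℤ} {n : ℕ} (h : ∀ k ≤ n, x k = y k) :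
    edgeProfile a N x n = edgeProfile a N y n := by
  funext e; simp only [edgeProfile, localTime_congr h]

lemma edgeProfile_of_mem {a : ℤ} {N : ℕ} {x : ℕ → ℤ} {n : ℕ} {e : ℤ} (h0 : 1 ≤ e) (h1 : e ≤ N) :
    edgeProfile a N x n e = localTime x n (a + e) := if_pos ⟨h0, h1⟩

lemma edgeProfile_zero_left (a : ℤ) (N : ℕ) (x : ℕ → ℤ) (n : ℕ) : edgeProfile a N x n 0 = 0 :=
  if_neg (by omega)

lemma edgeProfile_zero_right (a : ℤ) (N : ℕ) (x : ℕ → ℤ) (n : ℕ) :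
    edgeProfile a N x n (N + 1) = 0 := if_neg (by omega)

lemma edgeProfile_succ_right {a : ℤ} {N : ℕ} {x : ℕ → ℤ} {n : ℕ} (h : x (n + 1) = x n + 1)
    (h0 : a ≤ x n) (h1 : x n + 1 ≤ a + N) :
    edgeProfile a N x (n + 1) = edgeProfile a N x n + Pi.single (x n - a + 1) 1 := by
  funext e
  simp only [edgeProfile, Pi.add_apply, Pi.single_apply, localTime_succ_right h]
  by_cases he : e = x n - a + 1
  · rw [if_pos he, if_pos (by omega), if_pos (by omega), if_pos (by omega)]; push_cast; ring
  · rw [if_neg he, if_neg (by omega : ¬ (a + e = x n + 1))]; simp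

lemma edgeProfile_succ_left {a : ℤ} {N : ℕ} {x : ℕ → ℤ} {n : ℕ} (h : x (n + 1) = x n - 1)
    (h0 : a ≤ x n - 1) (h1 : x n ≤ a + N) :
    edgeProfile a N x (n + 1) = edgeProfile a N x n + Pi.single (x n - a) 1 := by
  funext e
  simp only [edgeProfile, Pi.add_apply, Pi.single_apply, localTime_succ_left h]
  by_cases he : e = x n - a
  · rw [if_pos he, if_pos (by omega), if_pos (by omega), if_pos (by omega)]; push_cast; ring
  · rw [if_neg he, if_neg (by omega : ¬ (a + e = x n))]; simp

/-- The inverse of the probability of staying in `[a, a + N]` at the next step. -/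
noncomputable def stayFactor (α β : ℝ) (a : ℤ) (N n : ℕ) (x : ℕ → ℤ) : ℝ :=
  if x n = a then 1 + Real.exp (-(2 * β * localStream α x n (x n)))
  else if x n = a + N then 1 + Real.exp (2 * β * localStream α x n (x n)) else 1

/-- The density, up to time `n₀ + k`, of the walk conditioned step by step to stay in
`[a, a + N]` after time `n₀`. -/
noncomputable def stayWeight (α β : ℝ) (a : ℤ) (N n₀ : ℕ) : ℕ → (ℕ → ℤ) → ℝ
  | 0, x => if a ≤ x n₀ ∧ x n₀ ≤ a + N then 1 else 0
  | k + 1, x => stayWeight α β a N n₀ k x * stayFactor α β a N (n₀ + k) x *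
      if a ≤ x (n₀ + k + 1) ∧ x (n₀ + k + 1) ≤ a + N then 1 else 0

section

variable {α β : ℝ} {a : ℤ} {N n₀ : ℕ}

lemma one_le_stayFactor (n : ℕ) (x : ℕ → ℤ) : 1 ≤ stayFactor α β a N n x := by
  unfold stayFactor
  split_ifs
  · linarith [Real.exp_pos (-(2 * β * localStream α x n (x n)))]
  · linarith [Real.exp_pos (2 * β * localStream α x n (x n))]
  · exact le_rfl

lemma dependsOn_stayFactor (n : ℕ) : DependsOn (stayFactor α β a N n) (Set.Iic n) := by
  intro x y h
  simp only [stayFactor, localStream_congr α (x := x) (y := y) fun k hk => h k hk,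
    h n (Set.mem_Iic.2 le_rfl)]

lemma dependsOn_stayWeight (k : ℕ) :
    DependsOn (stayWeight α β a N n₀ k) (Set.Iic (n₀ + k)) := by
  induction k with
  | zero => intro x y h; simp only [stayWeight, h n₀ (Set.mem_Iic.2 le_rfl)]
  | succ k ih =>
    intro x y h
    have h' : ∀ i ∈ Set.Iic (n₀ + k), x i = y i := fun i hi =>
      h i (Set.mem_Iic.2 (by have := Set.mem_Iic.1 hi; omega))
    simp only [stayWeight, ih h', dependsOn_stayFactor (n₀ + k) h',
      h (n₀ + k + 1) (Set.mem_Iic.2 le_rfl)]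

lemma stayWeight_nonneg (k : ℕ) (x : ℕ → ℤ) : 0 ≤ stayWeight α β a N n₀ k x := by
  induction k with
  | zero => simp only [stayWeight]; split_ifs <;> norm_num
  | succ k ih =>
    have := one_le_stayFactor (α := α) (β := β) (a := a) (N := N) (n₀ + k) x
    simp only [stayWeight]
    refine mul_nonneg (mul_nonneg ih (by linarith)) (by split_ifs <;> norm_num)

lemma mem_of_stayWeight_ne_zero {k : ℕ} {x : ℕ → ℤ} (h : stayWeight α β a N n₀ k x ≠ 0) :
    ∀ m, n₀ ≤ m → m ≤ n₀ + k → a ≤ x m ∧ x m ≤ a + N := by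
  induction k with
  | zero =>
    intro m h0 h1
    obtain rfl : m = n₀ := by omega
    by_contra hc
    exact h (if_neg hc)
  | succ k ih =>
    intro m h0 h1
    simp only [stayWeight] at h
    rcases (show m ≤ n₀ + k ∨ m = n₀ + k + 1 by omega) with h' | rfl
    · exact ih (left_ne_zero_of_mul (left_ne_zero_of_mul h)) m h0 h'
    · by_contra hc
      exact right_ne_zero_of_mul h (if_neg hc)

lemma one_le_stayWeight {k : ℕ} {x : ℕ → ℤ}
    (h : ∀ m, n₀ ≤ m → m ≤ n₀ + k → a ≤ x m ∧ x m ≤ a + N) :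
    1 ≤ stayWeight α β a N n₀ k x := by
  induction k with
  | zero => simp only [stayWeight]; rw [if_pos (h n₀ le_rfl le_rfl)]
  | succ k ih =>
    simp only [stayWeight]
    rw [if_pos (h _ (by omega) (by omega)), mul_one]
    exact one_le_mul_of_one_le_of_one_le (ih fun m h0 h1 => h m h0 (by omega))
      (one_le_stayFactor _ _)

lemma stayWeight_extendPath (k : ℕ) (x : ℕ → ℤ) (d : ℤ) :
    stayWeight α β a N n₀ (k + 1) (extendPath x (n₀ + k) d) =
      stayWeight α β a N n₀ k x * stayFactor α β a N (n₀ + k) x *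
        if a ≤ x (n₀ + k) + d ∧ x (n₀ + k) + d ≤ a + N then 1 else 0 := by
  simp only [stayWeight, extendPath_succ]
  rw [dependsOn_stayWeight k fun i hi => extendPath_of_le d hi,
    dependsOn_stayFactor (n₀ + k) fun i hi => extendPath_of_le d hi]

/-- At an end exactly one step stays inside and the factor is the inverse of its probability; `1 ≤
N` keeps the two ends apart. This is the martingale property of the stay weight. -/
lemma stay_prob_mul_factor (hN : 1 ≤ N) {n : ℕ} {x : ℕ → ℤ} (h0 : a ≤ x n) (h1 : x n ≤ a + N) :
    probRight α β n x * (stayFactor α β a N n x *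
        if a ≤ x n + 1 ∧ x n + 1 ≤ a + N then 1 else 0) +
      probLeft α β n x * (stayFactor α β a N n x *
        if a ≤ x n + -1 ∧ x n + -1 ≤ a + N then 1 else 0) = 1 := by
  unfold stayFactor
  by_cases ha : x n = a
  · rw [if_pos ha, if_pos (by omega), if_neg (by omega)]
    have := probRight_mul α β n x
    simpa using this
  by_cases hb : x n = a + N
  · rw [if_neg ha, if_pos hb, if_neg (by omega), if_pos (by omega)]
    have := probLeft_mul α β n x
    simpa using this
  · rw [if_neg ha, if_neg hb, if_pos (by omega), if_pos (by omega)]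
    simpa using probRight_add_probLeft α β n x

/-- While the walk is confined, its stream is a function of the inner local times, up to a
bounded error. -/
lemma abs_localStream_sub_le {x : ℕ → ℤ} {n : ℕ} (hn : n₀ ≤ n)
    (h : ∀ m, n₀ ≤ m → m ≤ n → a ≤ x m ∧ x m ≤ a + N) (y : ℤ) :
    |localStream α x n (a + y) - streamForm α (edgeProfile a N x n) y| ≤
      2 * (1 + |α|) * n₀ := by
  have key : ∀ e : ℤ, |(localTime x n (a + e) : ℝ) - edgeProfile a N x n e| ≤ n₀ := by
    intro e
    by_cases he : 1 ≤ e ∧ e ≤ N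
    · rw [edgeProfile, if_pos he, sub_self, abs_zero]; positivity
    · rw [edgeProfile, if_neg he, sub_zero, Nat.abs_cast, Nat.cast_le,
        localTime_eq_of_frozen hn]
      · exact localTime_le _ _ _
      · rcases (show e ≤ 0 ∨ N + 1 ≤ e by omega) with h' | h'
        · right; intro k a b; have := h k a b; omega
        · left; intro k a b; have := h k a b; omega
  have key' : ∀ e : ℤ, |α * ((localTime x n (a + e) : ℝ) - edgeProfile a N x n e)| ≤ |α| * n₀ :=
    fun e => by rw [abs_mul]; exact mul_le_mul_of_nonneg_left (key e) (abs_nonneg _)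
  have a1 := abs_le.1 (key' (y - 1))
  have a2 := abs_le.1 (key' (y + 2))
  have a3 := abs_le.1 (key y)
  have a4 := abs_le.1 (key (y + 1))
  rw [localStream, streamForm, abs_le, add_sub_assoc a y 1, add_assoc a y 1, add_assoc a y 2]
  constructor <;> linarith

/-- From `p (1 + e^{-2βs}) = 1` and `e^y ≥ 1 + y` one gets `p (-s) ≤ 1 / (2β)`: a step against the
stream has probability at most inversely proportional to its size, which is all that the drift
estimate needs. -/
lemma probRight_mul_le (hβ : 0 < β) {n : ℕ} {x : ℕ → ℤ} {K d : ℝ} (hK : 0 ≤ K)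
    (h : |localStream α x n (x n) - d| ≤ K) :
    probRight α β n x * max (-d) 0 ≤ K + 1 / (2 * β) := by
  have p0 := probRight_pos α β n x
  have p1 : probRight α β n x ≤ 1 := by
    linarith [probRight_add_probLeft α β n x, probLeft_pos α β n x]
  have p2 := probRight_mul α β n x
  have e := Real.add_one_le_exp (-(2 * β * localStream α x n (x n)))
  set s := localStream α x n (x n)
  have k1 : probRight α β n x * (-(2 * β * s)) ≤ 1 := by
    refine le_trans ?_ p2.le
    exact mul_le_mul_of_nonneg_left (by linarith) p0.le
  have k2 : probRight α β n x * (-s) ≤ 1 / (2 * β) := by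
    rw [le_div_iff₀ (by positivity)]; linarith
  have k3 := (abs_le.1 h).1
  have k3' := (abs_le.1 h).2
  rcases le_total (-d) 0 with hd | hd
  · rw [max_eq_right hd, mul_zero]; positivity
  · rw [max_eq_left hd]
    calc probRight α β n x * -d ≤ probRight α β n x * (-s + K) :=
          mul_le_mul_of_nonneg_left (by linarith) p0.le
      _ = probRight α β n x * (-s) + probRight α β n x * K := by ring
      _ ≤ _ := by nlinarith

lemma probLeft_mul_le (hβ : 0 < β) {n : ℕ} {x : ℕ → ℤ} {K d : ℝ} (hK : 0 ≤ K)
    (h : |localStream α x n (x n) - d| ≤ K) :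
    probLeft α β n x * max d 0 ≤ K + 1 / (2 * β) := by
  have p0 := probLeft_pos α β n x
  have p1 : probLeft α β n x ≤ 1 := by
    linarith [probRight_add_probLeft α β n x, probRight_pos α β n x]
  have p2 := probLeft_mul α β n x
  have e := Real.add_one_le_exp (2 * β * localStream α x n (x n))
  set s := localStream α x n (x n)
  have k1 : probLeft α β n x * (2 * β * s) ≤ 1 := by
    refine le_trans ?_ p2.le
    exact mul_le_mul_of_nonneg_left (by linarith) p0.le
  have k2 : probLeft α β n x * s ≤ 1 / (2 * β) := by
    rw [le_div_iff₀ (by positivity)]; linarith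
  have k3 := (abs_le.1 h).1
  have k3' := (abs_le.1 h).2
  rcases le_total d 0 with hd | hd
  · rw [max_eq_right hd, mul_zero]; positivity
  · rw [max_eq_left hd]
    calc probLeft α β n x * d ≤ probLeft α β n x * (s + K) :=
          mul_le_mul_of_nonneg_left (by linarith) p0.le
      _ = probLeft α β n x * s + probLeft α β n x * K := by ring
      _ ≤ _ := by nlinarith

/-- The Lyapunov function along a path. -/
noncomputable def StreamProfile.pathLyapunov (S : StreamProfile α N) (a : ℤ) (n : ℕ)
    (x : ℕ → ℤ) : ℝ := S.lyapunov (edgeProfile a N x n) (x n - a)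

/-- A bound for the drift of the Lyapunov function. -/
noncomputable def StreamProfile.driftBound (S : StreamProfile α N) (β : ℝ) (n₀ : ℕ) : ℝ :=
  S.stepBound + 8 * S.uMax * (2 * (1 + |α|) * n₀ + 1 / (2 * β))

lemma StreamProfile.dependsOn_pathLyapunov (S : StreamProfile α N) (a : ℤ) (n : ℕ) :
    DependsOn (S.pathLyapunov a n) (Set.Iic n) := by
  intro x y h
  simp only [StreamProfile.pathLyapunov, edgeProfile_congr a N (x := x) (y := y) fun k hk => h k hk,
    h n (Set.mem_Iic.2 le_rfl)]

lemma StreamProfile.dependsOn_energy (S : StreamProfile α N) (a : ℤ) (n : ℕ) :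
    DependsOn (fun x => S.energy (edgeProfile a N x n)) (Set.Iic n) := by
  intro x y h
  simp only [edgeProfile_congr a N (x := x) (y := y) fun k hk => h k hk]

lemma StreamProfile.pathLyapunov_right_le (S : StreamProfile α N) {n : ℕ} {x : ℕ → ℤ}
    (h0 : a ≤ x n) (h1 : x n + 1 ≤ a + N) :
    S.pathLyapunov a (n + 1) (extendPath x n 1) ≤ S.pathLyapunov a n x + S.stepBound +
      4 * S.u (x n - a) * max (-streamForm α (edgeProfile a N x n) (x n - a)) 0 := by
  have := S.lyapunov_right_le (edgeProfile a N x n) (x := x n - a) (by omega) (by omega)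
  unfold StreamProfile.pathLyapunov
  have hn : extendPath x n 1 n = x n := extendPath_of_le 1 le_rfl
  rw [edgeProfile_succ_right (by rw [extendPath_succ, hn]) (by omega) (by omega), hn,
    extendPath_succ, edgeProfile_congr a N (fun k hk => extendPath_of_le 1 hk)]
  rwa [show x n + 1 - a = x n - a + 1 by ring]

lemma StreamProfile.pathLyapunov_left_le (S : StreamProfile α N) {n : ℕ} {x : ℕ → ℤ}
    (h0 : a ≤ x n - 1) (h1 : x n ≤ a + N) :
    S.pathLyapunov a (n + 1) (extendPath x n (-1)) ≤ S.pathLyapunov a n x + S.stepBound +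
      4 * S.u (x n - a + 1) * max (streamForm α (edgeProfile a N x n) (x n - a)) 0 := by
  have := S.lyapunov_left_le (edgeProfile a N x n) (x := x n - a) (by omega) (by omega)
  unfold StreamProfile.pathLyapunov
  have hn : extendPath x n (-1) n = x n := extendPath_of_le (-1) le_rfl
  rw [edgeProfile_succ_left (by rw [extendPath_succ, hn]; ring) (by omega) (by omega), hn,
    extendPath_succ, edgeProfile_congr a N (fun k hk => extendPath_of_le (-1) hk)]
  rwa [show x n + -1 - a = x n - a - 1 by ring]

/-- The weighted Lyapunov function has bounded drift. -/
lemma StreamProfile.drift_le (S : StreamProfile α N) (hβ : 0 < β) (hN : 1 ≤ N) (k : ℕ)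
    (x : ℕ → ℤ) :
    probRight α β (n₀ + k) x * (stayWeight α β a N n₀ (k + 1) (extendPath x (n₀ + k) 1) *
        S.pathLyapunov a (n₀ + k + 1) (extendPath x (n₀ + k) 1)) +
      probLeft α β (n₀ + k) x * (stayWeight α β a N n₀ (k + 1) (extendPath x (n₀ + k) (-1)) *
        S.pathLyapunov a (n₀ + k + 1) (extendPath x (n₀ + k) (-1))) ≤
      stayWeight α β a N n₀ k x * (S.pathLyapunov a (n₀ + k) x + S.driftBound β n₀) := by
  rw [stayWeight_extendPath, stayWeight_extendPath]
  by_cases hw : stayWeight α β a N n₀ k x = 0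
  · simp [hw]
  have hmem := mem_of_stayWeight_ne_zero hw
  have hw0 := stayWeight_nonneg (α := α) (β := β) (a := a) (N := N) (n₀ := n₀) k x
  set n := n₀ + k with hn
  obtain ⟨h0, h1⟩ := hmem n (by omega) le_rfl
  have hprob := stay_prob_mul_factor (α := α) (β := β) hN h0 h1
  set w := stayWeight α β a N n₀ k x
  set f := stayFactor α β a N n x with hf
  have pr := probRight_pos α β n x
  have pl := probLeft_pos α β n x
  have hB := S.stepBound_nonneg
  have hU := S.uMax_nonneg
  have hK : 0 ≤ 2 * (1 + |α|) * n₀ := by positivity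
  have hK2 : 0 ≤ 2 * (1 + |α|) * n₀ + 1 / (2 * β) := by positivity
  have main : probRight α β n x * (f * (if a ≤ x n + 1 ∧ x n + 1 ≤ a + N then 1 else 0) *
        S.pathLyapunov a (n + 1) (extendPath x n 1)) +
      probLeft α β n x * (f * (if a ≤ x n + -1 ∧ x n + -1 ≤ a + N then 1 else 0) *
        S.pathLyapunov a (n + 1) (extendPath x n (-1))) ≤
      S.pathLyapunov a n x + S.driftBound β n₀ := by
    unfold StreamProfile.driftBound
    -- At an end the weighted step is forced and may go against a large stream, but its cost carries
    -- the factor `u 0 = 0` or `u (N + 1) = 0`.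
    by_cases ha : x n = a
    · have hr := S.pathLyapunov_right_le (a := a) (n := n) (x := x) h0 (by omega)
      rw [if_pos (by omega), if_neg (by omega)] at hprob ⊢
      rw [show x n - a = 0 by omega, S.u_zero] at hr
      simp only [mul_one, mul_zero, zero_mul, add_zero] at hprob hr ⊢
      rw [← mul_assoc, hprob, one_mul]
      nlinarith
    by_cases hb : x n = a + N
    · have hr := S.pathLyapunov_left_le (a := a) (n := n) (x := x) (by omega) h1
      rw [if_neg (by omega), if_pos (by omega)] at hprob ⊢
      rw [show x n - a + 1 = N + 1 by omega, S.u_end] at hr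
      simp only [mul_one, mul_zero, zero_mul, add_zero, zero_add] at hprob hr ⊢
      rw [← mul_assoc, hprob, one_mul]
      nlinarith
    · have hr := S.pathLyapunov_right_le (a := a) (n := n) (x := x) h0 (by omega)
      have hl := S.pathLyapunov_left_le (a := a) (n := n) (x := x) (by omega) h1
      have hs := abs_localStream_sub_le (α := α) (n := n) (by omega : n₀ ≤ n) hmem
        (x n - a)
      rw [add_sub_cancel] at hs
      have b1 := probRight_mul_le hβ hK hs
      have b2 := probLeft_mul_le hβ hK hs
      have u1 := S.u_nonneg (j := x n - a) (by omega) (by omega)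
      have u2 := S.u_nonneg (j := x n - a + 1) (by omega) (by omega)
      have v1 := S.u_le_uMax (j := x n - a) (by omega) (by omega)
      have v2 := S.u_le_uMax (j := x n - a + 1) (by omega) (by omega)
      have hf1 : f = 1 := by rw [hf, stayFactor, if_neg ha, if_neg hb]
      rw [if_pos (by omega), if_pos (by omega), hf1]
      simp only [one_mul]
      have c1 := mul_le_mul_of_nonneg_left hr pr.le
      have c2 := mul_le_mul_of_nonneg_left hl pl.le
      have d1 : S.u (x n - a) * (probRight α β n x *
          max (-streamForm α (edgeProfile a N x n) (x n - a)) 0) ≤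
          S.uMax * (2 * (1 + |α|) * n₀ + 1 / (2 * β)) :=
        (mul_le_mul_of_nonneg_left b1 u1).trans (mul_le_mul_of_nonneg_right v1 hK2)
      have d2 : S.u (x n - a + 1) * (probLeft α β n x *
          max (streamForm α (edgeProfile a N x n) (x n - a)) 0) ≤
          S.uMax * (2 * (1 + |α|) * n₀ + 1 / (2 * β)) :=
        (mul_le_mul_of_nonneg_left b2 u2).trans (mul_le_mul_of_nonneg_right v2 hK2)
      have hp := probRight_add_probLeft α β n x
      have hp' : probLeft α β n x = 1 - probRight α β n x := by linarith
      rw [hp'] at c2 d2 ⊢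
      linarith
  calc _ = w * _ := by ring
    _ ≤ _ := mul_le_mul_of_nonneg_left main hw0

end

/-! ### Expectations under the stay weight -/

namespace IsPushedWalk

variable {α β : ℝ} {Ω : Type*} [mΩ : MeasurableSpace Ω] {P : Measure Ω} [IsProbabilityMeasure P]
  {X : ℕ → Ω → ℤ} {a : ℤ} {N n₀ : ℕ}

/-- The stay weight is a martingale. -/
lemma integral_stayWeight_succ (hX : IsPushedWalk α β P X) (hN : 1 ≤ N) {k : ℕ}
    {Y : (ℕ → ℤ) → ℝ} (hY : DependsOn Y (Set.Iic (n₀ + k))) :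
    ∫ ω, stayWeight α β a N n₀ (k + 1) (fun i => X i ω) * Y (fun i => X i ω) ∂P =
      ∫ ω, stayWeight α β a N n₀ k (fun i => X i ω) * Y (fun i => X i ω) ∂P := by
  have hd : DependsOn (fun x => stayWeight α β a N n₀ (k + 1) x * Y x)
      (Set.Iic (n₀ + k + 1)) := by
    intro x y h
    beta_reduce
    rw [dependsOn_stayWeight (k + 1) h,
      hY fun i hi => h i (Set.mem_Iic.2 (by have := Set.mem_Iic.1 hi; omega))]
  rw [hX.integral_step hd]
  congr 1
  funext ω
  rw [stayWeight_extendPath, stayWeight_extendPath,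
    hY fun i hi => extendPath_of_le 1 hi, hY fun i hi => extendPath_of_le (-1) hi]
  set x : ℕ → ℤ := fun i => X i ω
  by_cases hw : stayWeight α β a N n₀ k x = 0
  · simp [hw]
  obtain ⟨h0, h1⟩ := mem_of_stayWeight_ne_zero hw (n₀ + k) (by omega) le_rfl
  have := stay_prob_mul_factor (α := α) (β := β) hN h0 h1
  linear_combination (stayWeight α β a N n₀ k x * Y x) * this

lemma integral_stayWeight_of_le (hX : IsPushedWalk α β P X) (hN : 1 ≤ N) {k k' : ℕ} (hk : k ≤ k')
    {Y : (ℕ → ℤ) → ℝ} (hY : DependsOn Y (Set.Iic (n₀ + k))) :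
    ∫ ω, stayWeight α β a N n₀ k' (fun i => X i ω) * Y (fun i => X i ω) ∂P =
      ∫ ω, stayWeight α β a N n₀ k (fun i => X i ω) * Y (fun i => X i ω) ∂P := by
  induction k', hk using Nat.le_induction with
  | base => rfl
  | succ m hm ih =>
    rw [hX.integral_stayWeight_succ hN (hY.mono (Set.Iic_subset_Iic.2 (by omega))), ih]

lemma integral_stayWeight (hX : IsPushedWalk α β P X) (hN : 1 ≤ N) (k : ℕ) :
    ∫ ω, stayWeight α β a N n₀ k (fun i => X i ω) ∂P =
      ∫ ω, stayWeight α β a N n₀ 0 (fun i => X i ω) ∂P := by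
  have := hX.integral_stayWeight_of_le (a := a) (n₀ := n₀) hN (Nat.zero_le k)
    (Y := fun _ => 1) (fun _ _ _ => rfl)
  simpa only [mul_one] using this

lemma integral_stayWeight_le_one (hX : IsPushedWalk α β P X) (hN : 1 ≤ N) (k : ℕ) :
    ∫ ω, stayWeight α β a N n₀ k (fun i => X i ω) ∂P ≤ 1 := by
  rw [hX.integral_stayWeight hN]
  calc _ ≤ ∫ ω, (1 : ℝ) ∂P := by
        refine integral_mono (hX.integrable (dependsOn_stayWeight 0)) (integrable_const 1)
          fun ω => ?_
        simp only [stayWeight]; split_ifs <;> norm_num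
    _ = 1 := by simp

/-- The weighted energy grows at most linearly. -/
lemma exists_integral_energy_le (hX : IsPushedWalk α β P X) (hβ : 0 < β) (hN : 1 ≤ N)
    (S : StreamProfile α N) (a : ℤ) (n₀ : ℕ) :
    ∃ C, 0 ≤ C ∧ ∀ k : ℕ, ∫ ω, stayWeight α β a N n₀ k (fun i => X i ω) *
      S.energy (edgeProfile a N (fun i => X i ω) (n₀ + k)) ∂P ≤ C * (k + 1) := by
  have hd : ∀ k, DependsOn (fun x => stayWeight α β a N n₀ k x * S.pathLyapunov a (n₀ + k) x)
      (Set.Iic (n₀ + k)) := fun k x y h => by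
    simp only [dependsOn_stayWeight k h, S.dependsOn_pathLyapunov a (n₀ + k) h]
  have hD : 0 ≤ S.driftBound β n₀ := by
    have := S.stepBound_nonneg
    have := S.uMax_nonneg
    unfold StreamProfile.driftBound
    positivity
  set I : ℕ → ℝ := fun k => ∫ ω, stayWeight α β a N n₀ k (fun i => X i ω) *
    S.pathLyapunov a (n₀ + k) (fun i => X i ω) ∂P with hI
  have step : ∀ k, I (k + 1) ≤ I k + S.driftBound β n₀ := by
    intro k
    have hw : Integrable (fun ω => stayWeight α β a N n₀ k (fun i => X i ω) *
        S.driftBound β n₀) P := (hX.integrable (dependsOn_stayWeight k)).mul_const _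
    calc I (k + 1) = _ := hX.integral_step (hd (k + 1))
      _ ≤ ∫ ω, (stayWeight α β a N n₀ k (fun i => X i ω) *
          S.pathLyapunov a (n₀ + k) (fun i => X i ω) +
          stayWeight α β a N n₀ k (fun i => X i ω) * S.driftBound β n₀) ∂P := by
        refine integral_mono ?_ ((hX.integrable (hd k)).add hw) fun ω => ?_
        · refine hX.integrable (n := n₀ + k) (Z := fun x => probRight α β (n₀ + k) x *
            (stayWeight α β a N n₀ (k + 1) (extendPath x (n₀ + k) 1) *
              S.pathLyapunov a (n₀ + (k + 1)) (extendPath x (n₀ + k) 1)) +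
            probLeft α β (n₀ + k) x *
            (stayWeight α β a N n₀ (k + 1) (extendPath x (n₀ + k) (-1)) *
              S.pathLyapunov a (n₀ + (k + 1)) (extendPath x (n₀ + k) (-1)))) fun x y h => ?_
          have e1 := dependsOn_extendPath (Z := fun x => stayWeight α β a N n₀ (k + 1) x *
            S.pathLyapunov a (n₀ + (k + 1)) x) (n₀ + k) 1 h
          have e2 := dependsOn_extendPath (Z := fun x => stayWeight α β a N n₀ (k + 1) x *
            S.pathLyapunov a (n₀ + (k + 1)) x) (n₀ + k) (-1) h
          simp only at e1 e2
          simp only [dependsOn_probRight α β (n₀ + k) h, dependsOn_probLeft α β (n₀ + k) h, e1, e2]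
        · have := S.drift_le (a := a) (n₀ := n₀) hβ hN k fun i => X i ω
          rw [mul_add] at this
          exact this
      _ = I k + (∫ ω, stayWeight α β a N n₀ k (fun i => X i ω) ∂P) * S.driftBound β n₀ := by
        rw [integral_add (hX.integrable (hd k)) hw, integral_mul_const]
      _ ≤ I k + S.driftBound β n₀ := by
        have := hX.integral_stayWeight_le_one (a := a) (n₀ := n₀) hN k
        nlinarith
  have hIk : ∀ k : ℕ, I k ≤ I 0 + S.driftBound β n₀ * k := by
    intro k
    induction k with
    | zero => simp
    | succ k ih => push_cast; linarith [step k]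
  refine ⟨|I 0| + S.driftBound β n₀, by positivity, fun k => ?_⟩
  have hle : ∫ ω, stayWeight α β a N n₀ k (fun i => X i ω) *
      S.energy (edgeProfile a N (fun i => X i ω) (n₀ + k)) ∂P ≤ I k := by
    refine integral_mono (hX.integrable (n := n₀ + k) (Z := fun x => stayWeight α β a N n₀ k x *
      S.energy (edgeProfile a N x (n₀ + k))) fun x y h => ?_) (hX.integrable (hd k)) fun ω => ?_
    · have := S.dependsOn_energy a (n₀ + k) h
      simp only at this
      simp only [dependsOn_stayWeight k h, this]
    · exact mul_le_mul_of_nonneg_left (S.energy_le_lyapunov _ _) (stayWeight_nonneg _ _)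
  have h1 := hIk k
  have h2 := le_abs_self (I 0)
  have h3 : (0 : ℝ) ≤ k := by positivity
  nlinarith [mul_nonneg (abs_nonneg (I 0)) h3]

end IsPushedWalk

/-! ### Asymptotics of confined walks -/

lemma edgeProfile_total {a : ℤ} {N n₀ k : ℕ} {x : ℕ → ℤ}
    (hx : ∀ n, x (n + 1) = x n + 1 ∨ x (n + 1) = x n - 1)
    (h : ∀ m, n₀ ≤ m → m ≤ n₀ + k → a ≤ x m ∧ x m ≤ a + N) :
    ∑ e ∈ Finset.Icc (1 : ℤ) N, edgeProfile a N x (n₀ + k) e =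
      ∑ e ∈ Finset.Icc (1 : ℤ) N, edgeProfile a N x n₀ e + k := by
  induction k with
  | zero => simp
  | succ k ih =>
    have h1 := h (n₀ + k) (by omega) (by omega)
    have h2 := h (n₀ + k + 1) (by omega) (by omega)
    have key : ∀ f : ℤ, 1 ≤ f → f ≤ N →
        ∑ e ∈ Finset.Icc (1 : ℤ) N, (Pi.single f 1 : ℤ → ℝ) e = 1 := fun f h0 h1 => by
      simp only [Pi.single_apply, Finset.sum_ite_eq', Finset.mem_Icc]
      rw [if_pos ⟨h0, h1⟩]
    have ih' := ih fun m h0 h1 => h m h0 (by omega)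
    rw [← add_assoc]
    rcases hx (n₀ + k) with h' | h'
    · rw [edgeProfile_succ_right h' (by omega) (by omega)]
      simp only [Pi.add_apply, Finset.sum_add_distrib]
      rw [key _ (by omega) (by omega), ih']
      push_cast; ring
    · rw [edgeProfile_succ_left h' (by omega) (by omega)]
      simp only [Pi.add_apply, Finset.sum_add_distrib]
      rw [key _ (by omega) (by omega), ih']
      push_cast; ring

lemma tendsto_const_div_sq_add_one (c : ℝ) :
    Tendsto (fun m : ℕ => c / ((m : ℝ) ^ 2 + 1)) atTop (nhds 0) := by
  refine Tendsto.div_atTop tendsto_const_nhds (tendsto_atTop_add_const_right _ _ ?_)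
  exact (tendsto_pow_atTop two_ne_zero).comp tendsto_natCast_atTop_atTop

lemma summable_const_div_sq_add_one (c : ℝ) : Summable fun m : ℕ => c / ((m : ℝ) ^ 2 + 1) := by
  have h : Summable fun m : ℕ => |c| * (((m + 1 : ℕ) : ℝ) ^ 2)⁻¹ * 2 :=
    (((summable_nat_add_iff 1).2 (Real.summable_nat_pow_inv.2 one_lt_two)).mul_left _).mul_right _
  refine Summable.of_norm_bounded h fun m => ?_
  rw [norm_div, Real.norm_eq_abs, Real.norm_of_nonneg (by positivity : 0 ≤ (m : ℝ) ^ 2 + 1),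
    mul_assoc, div_eq_mul_inv]
  refine mul_le_mul_of_nonneg_left ?_ (abs_nonneg c)
  push_cast
  rw [inv_mul_eq_div, inv_eq_one_div, div_le_div_iff₀ (by positivity) (by positivity)]
  nlinarith [sq_nonneg ((m : ℝ) - 1)]

lemma ae_tendsto_zero_of_summable_integral {Ω : Type*} [MeasurableSpace Ω] {P : Measure Ω}
    {f : ℕ → Ω → ℝ} (hf : ∀ m, Integrable (f m) P) (h0 : ∀ m ω, 0 ≤ f m ω) {b : ℕ → ℝ}
    (hb : Summable b) (h : ∀ m, ∫ ω, f m ω ∂P ≤ b m) :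
    ∀ᵐ ω ∂P, Tendsto (fun m => f m ω) atTop (nhds 0) := by
  have hs : ∑' m, ∫⁻ ω, ENNReal.ofReal (f m ω) ∂P ≠ ⊤ := by
    refine ne_top_of_le_ne_top hb.tsum_ofReal_ne_top (ENNReal.tsum_le_tsum fun m => ?_)
    rw [← ofReal_integral_eq_lintegral_ofReal (hf m) (Eventually.of_forall (h0 m))]
    exact ENNReal.ofReal_le_ofReal (h m)
  rw [← lintegral_tsum fun m => (hf m).aemeasurable.ennreal_ofReal] at hs
  filter_upwards [ae_lt_top' (AEMeasurable.tsum
    fun m => (hf m).aemeasurable.ennreal_ofReal) hs] with ω hω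
  have := (ENNReal.tendsto_toReal ENNReal.zero_ne_top).comp
    (ENNReal.tendsto_atTop_zero_of_tsum_ne_top hω.ne)
  refine (this.congr fun m => ?_).trans (by simp)
  simp [ENNReal.toReal_ofReal (h0 m ω)]

/-- On confinement the energy is negligible with respect to the square of the time. -/
lemma IsPushedWalk.ae_tendsto_energy {α β : ℝ} (hα : 0 < α) (hβ : 0 < β) {Ω : Type*}
    [MeasurableSpace Ω] {P : Measure Ω} [IsProbabilityMeasure P] {X : ℕ → Ω → ℤ}
    (hX : IsPushedWalk α β P X) {N : ℕ} (hN : 1 ≤ N) (S : StreamProfile α N) (a : ℤ) (n₀ : ℕ) :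
    ∀ᵐ ω ∂P, (∀ n, n₀ ≤ n → a ≤ X n ω ∧ X n ω ≤ a + N) →
      Tendsto (fun m : ℕ => S.energy (edgeProfile a N (fun i => X i ω) (n₀ + m ^ 2)) /
        ((m : ℝ) ^ 2 + 1) ^ 2) atTop (nhds 0) := by
  obtain ⟨C, hC, hE⟩ := hX.exists_integral_energy_le hβ hN S a n₀
  have hd : ∀ k, DependsOn (fun x => stayWeight α β a N n₀ k x *
      S.energy (edgeProfile a N x (n₀ + k))) (Set.Iic (n₀ + k)) := fun k x y h => by
    have := S.dependsOn_energy a (n₀ + k) h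
    simp only at this
    simp only [dependsOn_stayWeight k h, this]
  -- Along the squares the mean quotient is at most `C / (m ^ 2 + 1)`, hence summable, while
  -- consecutive squares differ by only `O(m)`.
  have := ae_tendsto_zero_of_summable_integral (P := P) (f := fun m ω =>
    stayWeight α β a N n₀ (m ^ 2) (fun i => X i ω) *
      S.energy (edgeProfile a N (fun i => X i ω) (n₀ + m ^ 2)) / ((m : ℝ) ^ 2 + 1) ^ 2)
    (fun m => (hX.integrable (hd (m ^ 2))).div_const _)
    (fun m ω => div_nonneg (mul_nonneg (stayWeight_nonneg _ _) (S.energy_nonneg hα _))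
      (by positivity)) (summable_const_div_sq_add_one C) (fun m => by
      rw [integral_div, div_le_div_iff₀ (by positivity) (by positivity)]
      have := hE (m ^ 2)
      push_cast at this
      calc _ ≤ C * ((m : ℝ) ^ 2 + 1) * ((m : ℝ) ^ 2 + 1) :=
            mul_le_mul_of_nonneg_right this (by positivity)
        _ = _ := by ring)
  filter_upwards [this] with ω hω hc
  refine squeeze_zero (fun m => div_nonneg (S.energy_nonneg hα _) (by positivity)) (fun m => ?_) hω
  refine div_le_div_of_nonneg_right ?_ (by positivity)
  -- On confinement the weight is at least `1`, so no change of measure is needed.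
  exact le_mul_of_one_le_left (S.energy_nonneg hα _) (one_le_stayWeight fun n h0 _ => hc n h0)

section

variable {α : ℝ} {N : ℕ} {S : StreamProfile α N} {a : ℤ} {n₀ : ℕ} {x : ℕ → ℤ}

/-- A functional that the energy controls up to a multiple of the total local time grows
linearly. -/
lemma StreamProfile.Controlled.tendsto
    (hx : ∀ n, x (n + 1) = x n + 1 ∨ x (n + 1) = x n - 1)
    (hc : ∀ n, n₀ ≤ n → a ≤ x n ∧ x n ≤ a + N)
    (hE : Tendsto (fun m : ℕ => S.energy (edgeProfile a N x (n₀ + m ^ 2)) /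
        ((m : ℝ) ^ 2 + 1) ^ 2) atTop (nhds 0)) {A : (ℤ → ℝ) → ℝ} {κ : ℝ}
    (hA : S.Controlled fun v => A v - κ * ∑ f ∈ Finset.Icc (1 : ℤ) N, v f) :
    Tendsto (fun m : ℕ => A (edgeProfile a N x (n₀ + m ^ 2)) / ((m : ℝ) ^ 2 + 1)) atTop
      (nhds κ) := by
  obtain ⟨C, hC, H⟩ := hA
  set T := ∑ e ∈ Finset.Icc (1 : ℤ) N, edgeProfile a N x n₀ e
  have ht : ∀ m : ℕ, ∑ e ∈ Finset.Icc (1 : ℤ) N, edgeProfile a N x (n₀ + m ^ 2) e =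
      T + (m : ℝ) ^ 2 := fun m => by
    rw [edgeProfile_total hx fun n h0 _ => hc n h0]; push_cast; rfl
  have h1 : Tendsto (fun m : ℕ => ((A (edgeProfile a N x (n₀ + m ^ 2)) - κ * (T + (m : ℝ) ^ 2)) /
      ((m : ℝ) ^ 2 + 1)) ^ 2) atTop (nhds 0) := by
    have := hE.const_mul C
    rw [mul_zero] at this
    refine squeeze_zero (fun m => sq_nonneg _) (fun m => ?_) this
    have := H _ (edgeProfile_zero_left a N x (n₀ + m ^ 2))
      (edgeProfile_zero_right a N x (n₀ + m ^ 2))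
    beta_reduce at this
    rw [ht] at this
    rw [div_pow, ← mul_div_assoc]
    exact div_le_div_of_nonneg_right this (by positivity)
  have h2 : Tendsto (fun m : ℕ => (A (edgeProfile a N x (n₀ + m ^ 2)) - κ * (T + (m : ℝ) ^ 2)) /
      ((m : ℝ) ^ 2 + 1)) atTop (nhds 0) := by
    have := h1.sqrt
    simp only [Real.sqrt_sq_eq_abs, Real.sqrt_zero] at this
    exact (tendsto_zero_iff_abs_tendsto_zero _).2 this
  have h3 := (h2.add (tendsto_const_div_sq_add_one (κ * (T - 1)))).add_const κ
  simp only [zero_add] at h3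
  refine h3.congr fun m => ?_
  field_simp
  ring

lemma edgeProfile_neg_one : edgeProfile a N x n₀ (-1) = 0 := if_neg (by omega)

lemma edgeProfile_end_add_two : edgeProfile a N x n₀ (N + 2) = 0 := if_neg (by omega)

lemma streamForm_left (n : ℕ) : streamForm α (edgeProfile a N x n) 0 =
    -edgeProfile a N x n 1 + α * edgeProfile a N x n 2 := by
  simp only [streamForm]
  norm_num [edgeProfile_neg_one, edgeProfile_zero_left]

lemma streamForm_right (n : ℕ) : streamForm α (edgeProfile a N x n) N =
    -(-edgeProfile a N x n N + α * edgeProfile a N x n (N - 1)) := by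
  simp only [streamForm, edgeProfile_zero_right, edgeProfile_end_add_two]
  ring

/-- Under confinement with negligible energy every site of the interval is visited infinitely
often. -/
lemma StreamProfile.frequently_visits (S : StreamProfile α N) (hα : 0 < α) (hN : 1 ≤ N)
    (hx : ∀ n, x (n + 1) = x n + 1 ∨ x (n + 1) = x n - 1)
    (hc : ∀ n, n₀ ≤ n → a ≤ x n ∧ x n ≤ a + N)
    (hE : Tendsto (fun m : ℕ => S.energy (edgeProfile a N x (n₀ + m ^ 2)) /
        ((m : ℝ) ^ 2 + 1) ^ 2) atTop (nhds 0)) {j : ℤ} (h0 : a ≤ j) (h1 : j ≤ a + N) :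
    ∃ᶠ n in atTop, x n = j := by
  intro hcon
  obtain ⟨n₁, hn₁⟩ := eventually_atTop.1 hcon
  obtain ⟨e, he1, heN, hej⟩ : ∃ e : ℕ, 1 ≤ e ∧ e ≤ N ∧ (a + e = j ∨ a + e = j + 1) := by
    rcases h0.eq_or_lt with rfl | h
    · exact ⟨1, le_rfl, hN, Or.inr (by push_cast; rfl)⟩
    · exact ⟨(j - a).toNat, by omega, by omega, Or.inl (by omega)⟩
  have hlim := (S.controlled_cross hα hN e (by omega)).tendsto hx hc hE
    (A := fun v => v e * ∑ f ∈ Finset.Icc (1 : ℤ) N, S.u f)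
  have hfro : ∀ n, localTime x n (a + e) ≤ n₁ := by
    intro n
    rcases le_total n n₁ with h | h
    · exact (localTime_le _ _ _).trans h
    · rw [localTime_eq_of_frozen h]
      · exact localTime_le _ _ _
      · rcases hej with h | h
        · left; intro k hk _; rw [h]; exact hn₁ k hk
        · right; intro k hk _; rw [h, add_sub_cancel_right]; exact hn₁ k hk
  have hS : 0 ≤ ∑ f ∈ Finset.Icc (1 : ℤ) N, S.u f := Finset.sum_nonneg fun f hf => by
    rw [Finset.mem_Icc] at hf
    exact (S.u_pos f hf.1 hf.2).le
  have hzero := squeeze_zero (f := fun m : ℕ => edgeProfile a N x (n₀ + m ^ 2) e *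
      (∑ f ∈ Finset.Icc (1 : ℤ) N, S.u f) / ((m : ℝ) ^ 2 + 1)) (fun m => ?_) (fun m => ?_)
    (tendsto_const_div_sq_add_one (n₁ * ∑ f ∈ Finset.Icc (1 : ℤ) N, S.u f))
  · have := tendsto_nhds_unique hlim hzero
    have := S.u_pos e (by omega) (by omega)
    linarith
  · rw [edgeProfile_of_mem (by omega) (by omega)]; positivity
  · rw [edgeProfile_of_mem (by omega) (by omega)]
    gcongr
    exact_mod_cast hfro _

lemma sqrt_decomp (k : ℕ) : ∃ j, k = Nat.sqrt k ^ 2 + j ∧ j ≤ 2 * Nat.sqrt k :=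
  ⟨k - Nat.sqrt k ^ 2, by have := Nat.sqrt_le' k; omega, by
    have := Nat.sqrt_le_add k
    rw [sq]; omega⟩

end

/-- If the profile pushes outwards, the walk is not confined. -/
lemma IsPushedWalk.ae_not_confined_of_outward {α β : ℝ} (hα : 0 < α) (hβ : 0 < β) {Ω : Type*}
    [MeasurableSpace Ω] {P : Measure Ω} [IsProbabilityMeasure P] {X : ℕ → Ω → ℤ}
    (hX : IsPushedWalk α β P X) {N : ℕ} (hN : 1 ≤ N) (S : StreamProfile α N) (hS : S.u (-1) < 0)
    (a : ℤ) (n₀ : ℕ) :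
    ∀ᵐ ω ∂P, ¬ ((∀ n, n₀ ≤ n → a ≤ X n ω ∧ X n ω ≤ a + N) ∧ ∃ᶠ n in atTop, X n ω = a) := by
  filter_upwards [hX.ae_frequently_left hβ a, hX.ae_nearest_neighbour,
    hX.ae_tendsto_energy hα hβ hN S a n₀] with ω hL hx hE hcf
  obtain ⟨hc, hf⟩ := hcf
  set x : ℕ → ℤ := fun i => X i ω with hxdef
  have hU : 0 < ∑ f ∈ Finset.Icc (1 : ℤ) N, S.u f := Finset.sum_pos (fun f hf => by
    rw [Finset.mem_Icc] at hf
    exact S.u_pos f hf.1 hf.2) ⟨1, by simp; omega⟩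
  have hlim := (S.controlled_left hα hN).tendsto hx hc (hE hc)
    (A := fun v => (-v 1 + α * v 2) * ∑ f ∈ Finset.Icc (1 : ℤ) N, S.u f)
  set U := ∑ f ∈ Finset.Icc (1 : ℤ) N, S.u f
  -- Half of the limiting outward speed, which leaves room for a strict inequality.
  set c := -(α * S.u (-1)) / 2 / U with hcdef
  have hpos : 0 < -(α * S.u (-1)) := by nlinarith
  have hc0 : 0 < c := by positivity
  have hev := hlim.eventually_lt_const (show α * S.u (-1) < -(c * U) by
    rw [hcdef]; field_simp; linarith)
  obtain ⟨M, hM⟩ := eventually_atTop.1 hev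
  set B := 2 * (1 + |α|) with hB
  have hB0 : 0 ≤ B := by positivity
  have hbound : ∀ᶠ n in atTop, localStream α x n a ≤ B * n₀ + B ^ 2 / c := by
    filter_upwards [eventually_ge_atTop (n₀ + M ^ 2)] with n hn
    obtain ⟨k, rfl⟩ := Nat.exists_eq_add_of_le (show n₀ ≤ n by omega)
    obtain ⟨j, hj, hj'⟩ := sqrt_decomp k
    set m := Nat.sqrt k
    have hmM : M ≤ m := Nat.le_sqrt'.2 (by omega)
    have e1 := (abs_le.1 (localStream_add_le α x (n₀ + m ^ 2) j a)).2
    rw [add_assoc, ← hj] at e1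
    have e2 := (abs_le.1 (abs_localStream_sub_le (α := α) (n := n₀ + m ^ 2) (by omega)
      (fun n h _ => hc n h) 0)).2
    rw [add_zero, streamForm_left] at e2
    have e3 := hM m hmM
    rw [div_lt_iff₀ (by positivity)] at e3
    have e4 : -edgeProfile a N x (n₀ + m ^ 2) 1 + α * edgeProfile a N x (n₀ + m ^ 2) 2 ≤
        -c * ((m : ℝ) ^ 2 + 1) := by
      refine le_of_mul_le_mul_right ?_ hU
      linarith
    have e5 : (j : ℝ) ≤ 2 * m := by exact_mod_cast hj'
    have e6 : B * j ≤ B * (2 * m) := mul_le_mul_of_nonneg_left e5 hB0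
    -- Between consecutive squares the stream moves by at most `B * (2 * m)`; completing the square
    -- absorbs this in the linear drift.
    have e7 : B * (2 * m) ≤ c * (m : ℝ) ^ 2 + B ^ 2 / c := by
      have : 0 ≤ (c * m - B) ^ 2 / c := by positivity
      have h' : (c * m - B) ^ 2 / c = c * (m : ℝ) ^ 2 + B ^ 2 / c - B * (2 * m) := by
        field_simp; ring
      linarith
    linarith
  -- A stream bounded above at `a` forces infinitely many visits to `a - 1`, outside the interval.
  obtain ⟨n, hn, hn'⟩ := ((hL _ (hf.and_eventually hbound)).and_eventually
    (eventually_ge_atTop n₀)).exists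
  have := (hc n hn').1
  omega

/-- If `α ≤ 0`, the walk is not confined. -/
lemma IsPushedWalk.ae_not_confined_of_nonpos {α β : ℝ} (hα : α ≤ 0) (hβ : 0 < β) {Ω : Type*}
    [MeasurableSpace Ω] {P : Measure Ω} [IsProbabilityMeasure P] {X : ℕ → Ω → ℤ}
    (hX : IsPushedWalk α β P X) (N : ℕ) (a : ℤ) (n₀ : ℕ) :
    ∀ᵐ ω ∂P, ¬ ((∀ n, n₀ ≤ n → a ≤ X n ω ∧ X n ω ≤ a + N) ∧ ∃ᶠ n in atTop, X n ω = a) := by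
  filter_upwards [hX.ae_frequently_left hβ a] with ω hL hcf
  obtain ⟨hc, hf⟩ := hcf
  set x : ℕ → ℤ := fun i => X i ω with hxdef
  have hbound : ∀ᶠ n in atTop, localStream α x n a ≤ 2 * (1 + |α|) * n₀ := by
    filter_upwards [eventually_ge_atTop n₀] with n hn
    have e2 := (abs_le.1 (abs_localStream_sub_le (α := α) (n := n) hn
      (fun n h _ => hc n h) 0)).2
    rw [add_zero, streamForm_left] at e2
    have p : ∀ e, 0 ≤ edgeProfile a N x n e := fun e => by
      unfold edgeProfile; split_ifs <;> positivity
    have := mul_nonneg (neg_nonneg.2 hα) (p 2)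
    linarith [p 1]
  obtain ⟨n, hn, hn'⟩ := ((hL _ (hf.and_eventually hbound)).and_eventually
    (eventually_ge_atTop n₀)).exists
  have := (hc n hn').1
  omega

/-! ### Confinement with positive probability -/

/-- The choice of `ε` bounds the deviation of `A v` from `κ m ^ 2` by `κ / 4 * (m ^ 2 + 1)`, at most
`κ / 2 * m ^ 2` because `m ≥ 1`. The denominator `C + 1` covers `C = 0`. -/
lemma StreamProfile.controlled_pos_bound {α : ℝ} {N : ℕ} (S : StreamProfile α N) {A : (ℤ → ℝ) → ℝ}
    {κ : ℝ} (hκ : 0 < κ) (hA : S.Controlled fun v => A v - κ * ∑ f ∈ Finset.Icc (1 : ℤ) N, v f) :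
    ∃ ε > 0, ∀ v : ℤ → ℝ, v 0 = 0 → v (N + 1) = 0 → ∀ m : ℝ, 1 ≤ m →
      ∑ f ∈ Finset.Icc (1 : ℤ) N, v f = m ^ 2 → S.energy v ≤ ε * (m ^ 2 + 1) ^ 2 →
      κ / 2 * m ^ 2 ≤ A v := by
  obtain ⟨C, hC, H⟩ := hA
  refine ⟨(κ / 4) ^ 2 / (C + 1), by positivity, fun v h0 h1 m hm hs hE => ?_⟩
  have h2 : (A v - κ * m ^ 2) ^ 2 ≤ (κ / 4 * (m ^ 2 + 1)) ^ 2 := by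
    have := H v h0 h1
    beta_reduce at this
    rw [hs] at this
    refine this.trans ((mul_le_mul_of_nonneg_left hE hC).trans ?_)
    rw [mul_pow, ← mul_assoc]
    refine mul_le_mul_of_nonneg_right ?_ (by positivity)
    rw [← mul_div_assoc, div_le_iff₀ (by positivity)]
    nlinarith [sq_nonneg (κ / 4)]
  have := (abs_le_of_sq_le_sq' h2 (by positivity)).1
  have := mul_le_mul_of_nonneg_left (one_le_pow₀ hm : 1 ≤ m ^ 2) hκ.le
  linarith

section

variable {α β : ℝ} {N : ℕ} (S : StreamProfile α N)

/-- The energy at time `m ^ 2` is small. -/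
def StreamProfile.SmallEnergy (ε : ℝ) (m : ℕ) (x : ℕ → ℤ) : Prop :=
  S.energy (edgeProfile 0 N x (m ^ 2)) ≤ ε * ((m : ℝ) ^ 2 + 1) ^ 2

/-- Carries a linear lower bound from time `m ^ 2` to the times `m ^ 2 + j` before the next square,
by completing the square. -/
lemma quadratic_lower {c B m j : ℝ} (hc : 0 < c) (hB : 0 ≤ B) (hj : j ≤ 2 * m) :
    c / 2 * (m ^ 2 + j) - (2 * B + c) ^ 2 / (2 * c) ≤ c * m ^ 2 - B * j := by
  have h1 : 0 ≤ (c * m - (2 * B + c)) ^ 2 / (2 * c) := by positivity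
  have h2 : (c * m - (2 * B + c)) ^ 2 / (2 * c) =
      c / 2 * m ^ 2 - (2 * B + c) * m + (2 * B + c) ^ 2 / (2 * c) := by
    field_simp; ring
  nlinarith [mul_le_mul_of_nonneg_left hj hB, mul_le_mul_of_nonneg_left hj hc.le]

/-- While the energy is small, the streams at both ends push inwards at linear speed. -/
lemma StreamProfile.exists_stream_bounds (hα : 0 < α) (hN : 1 ≤ N) (h1 : 0 < S.u (-1))
    (h2 : 0 < S.u (N + 2)) :
    ∃ ε > 0, ∃ c > 0, ∃ B, ∀ (x : ℕ → ℤ) (k : ℕ),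
      (∀ n, x (n + 1) = x n + 1 ∨ x (n + 1) = x n - 1) →
      (∀ m ≤ k, 0 ≤ x m ∧ x m ≤ N) → 1 ≤ Nat.sqrt k → S.SmallEnergy ε (Nat.sqrt k) x →
      c * k - B ≤ localStream α x k 0 ∧ localStream α x k N ≤ -(c * k - B) := by
  obtain ⟨ε₁, hε₁, H₁⟩ := S.controlled_pos_bound (by positivity) (S.controlled_left hα hN)
    (A := fun v => (-v 1 + α * v 2) * ∑ f ∈ Finset.Icc (1 : ℤ) N, S.u f)
  obtain ⟨ε₂, hε₂, H₂⟩ := S.controlled_pos_bound (by positivity) (S.controlled_right hα hN)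
    (A := fun v => (-v N + α * v (N - 1)) * ∑ f ∈ Finset.Icc (1 : ℤ) N, S.u f)
  have hU : 0 < ∑ f ∈ Finset.Icc (1 : ℤ) N, S.u f := Finset.sum_pos (fun f hf => by
    rw [Finset.mem_Icc] at hf
    exact S.u_pos f hf.1 hf.2) ⟨1, by simp; omega⟩
  set U := ∑ f ∈ Finset.Icc (1 : ℤ) N, S.u f
  set κ := min (α * S.u (-1)) (α * S.u (N + 2))
  have hκ : 0 < κ := lt_min (by positivity) (by positivity)
  set c := κ / 2 / U with hcdef
  have hc : 0 < c := by positivity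
  have hcU : c * U = κ / 2 := by rw [hcdef]; field_simp
  set D := 2 * (1 + |α|) with hD
  have hD0 : 0 ≤ D := by positivity
  refine ⟨min ε₁ ε₂, lt_min hε₁ hε₂, c / 2, by positivity, (2 * D + c) ^ 2 / (2 * c), ?_⟩
  intro x k hx hmem hm hE
  obtain ⟨j, hj, hj'⟩ := sqrt_decomp k
  set m := Nat.sqrt k
  have hkr : (k : ℝ) = (m : ℝ) ^ 2 + j := by exact_mod_cast hj
  have hjr : (j : ℝ) ≤ 2 * m := by exact_mod_cast hj'
  have hmr : (1 : ℝ) ≤ m := by exact_mod_cast hm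
  have hmem' : ∀ i, 0 ≤ i → i ≤ m ^ 2 → (0 : ℤ) ≤ x i ∧ x i ≤ 0 + N := fun i _ hi => by
    rw [zero_add]; exact hmem i (by omega)
  have htot : ∑ f ∈ Finset.Icc (1 : ℤ) N, edgeProfile 0 N x (m ^ 2) f = (m : ℝ) ^ 2 := by
    have := edgeProfile_total (a := 0) (N := N) (n₀ := 0) (k := m ^ 2) hx
      (by simpa using hmem')
    rw [zero_add] at this
    rw [this]
    simp [edgeProfile, localTime_zero]
  have z0 := edgeProfile_zero_left 0 N x (m ^ 2)
  have z1 := edgeProfile_zero_right 0 N x (m ^ 2)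
  have b1 := H₁ _ z0 z1 m hmr htot (hE.trans (by gcongr; exact min_le_left _ _))
  have b2 := H₂ _ z0 z1 m hmr htot (hE.trans (by gcongr; exact min_le_right _ _))
  beta_reduce at b1 b2
  rw [← streamForm_left] at b1
  rw [← neg_neg (-edgeProfile 0 N x (m ^ 2) N + _), ← streamForm_right] at b2
  have s1 := abs_localStream_sub_le (α := α) (n₀ := 0) (Nat.zero_le (m ^ 2)) hmem' 0
  have s2 := abs_localStream_sub_le (α := α) (n₀ := 0) (Nat.zero_le (m ^ 2)) hmem' N
  simp only [Nat.cast_zero, mul_zero, add_zero, zero_add, abs_nonpos_iff, sub_eq_zero] at s1 s2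
  rw [← s1] at b1
  rw [← s2] at b2
  have c1 : c * (m : ℝ) ^ 2 ≤ localStream α x (m ^ 2) 0 := by
    refine le_of_mul_le_mul_right ?_ hU
    have : κ / 2 * (m : ℝ) ^ 2 ≤ α * S.u (-1) / 2 * (m : ℝ) ^ 2 := by
      gcongr; exact min_le_left _ _
    calc _ = c * U * (m : ℝ) ^ 2 := by ring
      _ ≤ _ := by rw [hcU]; linarith
  have c2 : c * (m : ℝ) ^ 2 ≤ -localStream α x (m ^ 2) N := by
    refine le_of_mul_le_mul_right ?_ hU
    have : κ / 2 * (m : ℝ) ^ 2 ≤ α * S.u (N + 2) / 2 * (m : ℝ) ^ 2 := by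
      gcongr; exact min_le_right _ _
    calc _ = c * U * (m : ℝ) ^ 2 := by ring
      _ ≤ _ := by rw [hcU]; linarith
  have d1 := (abs_le.1 (localStream_add_le α x (m ^ 2) j 0)).1
  have d2 := (abs_le.1 (localStream_add_le α x (m ^ 2) j N)).2
  rw [← hj] at d1 d2
  have q := quadratic_lower hc hD0 hjr
  rw [hkr]
  constructor <;> linarith

/-- The double exponential turns the product of the factors into the exponential of a convergent
series once `s` grows linearly. -/
lemma stayFactor_le (hβ : 0 < β) {x : ℕ → ℤ} {k : ℕ} {s : ℝ} (h0 : s ≤ localStream α x k 0)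
    (h1 : localStream α x k N ≤ -s) :
    stayFactor α β 0 N k x ≤ Real.exp (Real.exp (-(2 * β * s))) := by
  unfold stayFactor
  split_ifs with ha hb
  · rw [ha, add_comm]
    refine (Real.add_one_le_exp _).trans (Real.exp_le_exp.2 (Real.exp_le_exp.2 ?_))
    nlinarith
  · rw [hb, add_comm, zero_add]
    refine (Real.add_one_le_exp _).trans (Real.exp_le_exp.2 (Real.exp_le_exp.2 ?_))
    nlinarith
  · exact Real.one_le_exp (Real.exp_pos _).le

lemma summable_exp_linear {c : ℝ} (hc : 0 < c) (B : ℝ) :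
    Summable fun k : ℕ => Real.exp (-(c * k - B)) := by
  have := (Real.summable_exp_nat_mul_of_ge (c := -c) (by linarith) (f := fun k : ℕ => (k : ℝ))
    fun i => le_rfl).mul_left (Real.exp B)
  refine this.congr fun k => ?_
  rw [← Real.exp_add]; congr 1; ring

/-- On the event that the energies are small the stay weight is bounded. -/
lemma StreamProfile.exists_stayWeight_bound (hα : 0 < α) (hβ : 0 < β) (hN : 1 ≤ N)
    (h1 : 0 < S.u (-1)) (h2 : 0 < S.u (N + 2)) :
    ∃ ε > 0, ∀ M : ℕ, 1 ≤ M → ∃ B, ∀ (x : ℕ → ℤ) (k : ℕ),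
      (∀ n, x (n + 1) = x n + 1 ∨ x (n + 1) = x n - 1) →
      (∀ m, M ≤ m → m ^ 2 ≤ k → S.SmallEnergy ε m x) → stayWeight α β 0 N 0 k x ≤ B := by
  obtain ⟨ε, hε, c, hc, B, H⟩ := S.exists_stream_bounds hα hN h1 h2
  refine ⟨ε, hε, fun M hM => ?_⟩
  set D := 2 * (1 + |α|) with hD
  -- Before time `M ^ 2` no energy is assumed small; there the stream is at most `D` times the time,
  -- and the second entry of the maximum absorbs it.
  set B' := max B ((D + c) * (M : ℝ) ^ 2) with hB'
  set g : ℕ → ℝ := fun k => Real.exp (-(2 * β * (c * k - B'))) with hg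
  have hgs : Summable g := by
    refine (summable_exp_linear (c := 2 * β * c) (by positivity) (2 * β * B')).congr fun k => ?_
    simp only [hg]; congr 1; ring
  refine ⟨Real.exp (∑' k, g k), fun x k hx hs => ?_⟩
  have key : ∀ i ≤ k, stayWeight α β 0 N 0 i x ≤ Real.exp (∑ j ∈ Finset.range i, g j) := by
    intro i hi
    induction i with
    | zero => simp only [stayWeight, Finset.range_zero, Finset.sum_empty, Real.exp_zero]
              split_ifs <;> norm_num
    | succ i ih =>
      have ih' := ih (by omega)
      have hw0 := stayWeight_nonneg (α := α) (β := β) (a := 0) (N := N) (n₀ := 0) i x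
      simp only [stayWeight]
      rw [Finset.sum_range_succ, Real.exp_add, zero_add]
      by_cases hw : stayWeight α β 0 N 0 i x = 0
      · rw [hw, zero_mul, zero_mul]; positivity
      have hmem : ∀ m ≤ i, 0 ≤ x m ∧ x m ≤ N := fun m hm => by
        have := mem_of_stayWeight_ne_zero hw m (by omega) (by omega)
        rwa [zero_add] at this
      have hf : stayFactor α β 0 N i x ≤ Real.exp (g i) := by
        have hbd : c * i - B' ≤ localStream α x i 0 ∧ localStream α x i N ≤ -(c * i - B') := by
          rcases le_or_gt M (Nat.sqrt i) with hMi | hMi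
          · have hsq := Nat.sqrt_le' i
            have := H x i hx hmem (by omega) (hs _ hMi (by omega))
            have hle := le_max_left B ((D + c) * (M : ℝ) ^ 2)
            constructor <;> linarith
          · have hi2 : (i : ℝ) ≤ (M : ℝ) ^ 2 := by
              exact_mod_cast (Nat.sqrt_lt'.1 hMi).le
            have a1 := (abs_le.1 (abs_localStream_le α x i 0)).1
            have a2 := (abs_le.1 (abs_localStream_le α x i N)).2
            have hDc : 0 ≤ D + c := by positivity
            have hle := le_max_right B ((D + c) * (M : ℝ) ^ 2)
            have := mul_le_mul_of_nonneg_left hi2 hDc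
            constructor <;> linarith
        exact stayFactor_le hβ hbd.1 hbd.2
      have hf0 := one_le_stayFactor (α := α) (β := β) (a := 0) (N := N) i x
      calc _ ≤ stayWeight α β 0 N 0 i x * stayFactor α β 0 N i x * 1 := by
            refine mul_le_mul_of_nonneg_left (by split_ifs <;> norm_num)
              (mul_nonneg hw0 (by linarith))
        _ = stayWeight α β 0 N 0 i x * stayFactor α β 0 N i x := mul_one _
        _ ≤ _ := mul_le_mul ih' hf (by linarith) (by positivity)
  exact (key k le_rfl).trans (Real.exp_le_exp.2
    (hgs.sum_le_tsum _ fun j _ => (Real.exp_pos _).le))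

open Classical in
/-- The indicator that the energy at time `m ^ 2` is not small. -/
noncomputable def StreamProfile.largeEnergy (ε : ℝ) (m : ℕ) (x : ℕ → ℤ) : ℝ :=
  if S.SmallEnergy ε m x then 0 else 1

lemma StreamProfile.largeEnergy_nonneg (ε : ℝ) (m : ℕ) (x : ℕ → ℤ) :
    0 ≤ S.largeEnergy ε m x := by
  unfold StreamProfile.largeEnergy; split_ifs <;> norm_num

lemma StreamProfile.dependsOn_largeEnergy (ε : ℝ) (m : ℕ) :
    DependsOn (S.largeEnergy ε m) (Set.Iic (m ^ 2)) := by
  intro x y h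
  have hiff : S.SmallEnergy ε m x ↔ S.SmallEnergy ε m y := by
    simp only [StreamProfile.SmallEnergy,
      edgeProfile_congr 0 N (x := x) (y := y) fun k hk => h k hk]
  unfold StreamProfile.largeEnergy
  by_cases hs : S.SmallEnergy ε m x
  · rw [if_pos hs, if_pos (hiff.1 hs)]
  · rw [if_neg hs, if_neg (mt hiff.2 hs)]

lemma StreamProfile.largeEnergy_le (hα : 0 < α) {ε : ℝ} (hε : 0 < ε) (m : ℕ) (x : ℕ → ℤ) :
    S.largeEnergy ε m x ≤
      S.energy (edgeProfile 0 N x (m ^ 2)) / (ε * ((m : ℝ) ^ 2 + 1) ^ 2) := by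
  have hE := S.energy_nonneg hα (edgeProfile 0 N x (m ^ 2))
  unfold StreamProfile.largeEnergy
  split_ifs with h
  · positivity
  · rw [StreamProfile.SmallEnergy, not_le] at h
    rw [one_le_div (by positivity)]
    exact h.le

end

/-- If the profile pushes inwards, then with positive probability the walk never leaves
`[0, N]`. -/
lemma IsPushedWalk.confined_pos {α β : ℝ} (hα : 0 < α) (hβ : 0 < β) {Ω : Type*}
    [MeasurableSpace Ω] {P : Measure Ω} [IsProbabilityMeasure P] {X : ℕ → Ω → ℤ}
    (hX : IsPushedWalk α β P X) {N : ℕ} (hN : 1 ≤ N) (S : StreamProfile α N) (h1 : 0 < S.u (-1))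
    (h2 : 0 < S.u (N + 2)) : 0 < P {ω | ∀ n, 0 ≤ X n ω ∧ X n ω ≤ N} := by
  obtain ⟨ε, hε, hbound⟩ := S.exists_stayWeight_bound hα hβ hN h1 h2
  obtain ⟨C, hC, hE⟩ := hX.exists_integral_energy_le hβ hN S 0 0
  simp only [zero_add] at hE
  set b : ℕ → ℝ := fun m => C / ε / ((m : ℝ) ^ 2 + 1) with hb
  have hbs : Summable b := summable_const_div_sq_add_one _
  have hb0 : ∀ m, 0 ≤ b m := fun m => by positivity
  -- Under the weight, a large energy at some square `m ^ 2` with `m ≥ M` has probability below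
  -- `1/2`.
  obtain ⟨M, hM1, hM⟩ : ∃ M : ℕ, 1 ≤ M ∧ ∑' i, b (i + M) < 1 / 2 := by
    obtain ⟨M, hM⟩ := eventually_atTop.1
      ((tendsto_sum_nat_add b).eventually_lt_const (show (0 : ℝ) < 1 / 2 by norm_num))
    exact ⟨M + 1, by omega, hM _ (by omega)⟩
  obtain ⟨B, hB⟩ := hbound M hM1
  have hlarge : ∀ m k : ℕ, m ^ 2 ≤ k →
      ∫ ω, stayWeight α β 0 N 0 k (fun i => X i ω) * S.largeEnergy ε m (fun i => X i ω) ∂P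
        ≤ b m := by
    intro m k hmk
    rw [hX.integral_stayWeight_of_le hN hmk (by
      rw [zero_add]; exact S.dependsOn_largeEnergy ε m)]
    have hd : DependsOn (fun x => stayWeight α β 0 N 0 (m ^ 2) x * S.largeEnergy ε m x)
        (Set.Iic (m ^ 2)) := fun x y h => by
      have hw := dependsOn_stayWeight (α := α) (β := β) (a := 0) (N := N) (n₀ := 0) (m ^ 2)
        (x := x) (y := y) (by rwa [zero_add])
      simp only [hw, S.dependsOn_largeEnergy ε m h]
    have hd' : DependsOn (fun x => stayWeight α β 0 N 0 (m ^ 2) x *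
        S.energy (edgeProfile 0 N x (m ^ 2))) (Set.Iic (m ^ 2)) := fun x y h => by
      have hw := dependsOn_stayWeight (α := α) (β := β) (a := 0) (N := N) (n₀ := 0) (m ^ 2)
        (x := x) (y := y) (by rwa [zero_add])
      have he := S.dependsOn_energy 0 (m ^ 2) h
      simp only at he
      simp only [hw, he]
    calc _ ≤ ∫ ω, stayWeight α β 0 N 0 (m ^ 2) (fun i => X i ω) *
          S.energy (edgeProfile 0 N (fun i => X i ω) (m ^ 2)) /
            (ε * ((m : ℝ) ^ 2 + 1) ^ 2) ∂P := by
          refine integral_mono (hX.integrable hd) ((hX.integrable hd').div_const _) fun ω => ?_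
          rw [mul_div_assoc]
          exact mul_le_mul_of_nonneg_left (S.largeEnergy_le hα hε m _) (stayWeight_nonneg _ _)
      _ ≤ b m := by
          simp only [hb]
          rw [integral_div, div_div, div_le_div_iff₀ (by positivity) (by positivity)]
          have := hE (m ^ 2)
          push_cast at this
          calc _ ≤ C * ((m : ℝ) ^ 2 + 1) * (ε * ((m : ℝ) ^ 2 + 1)) :=
                mul_le_mul_of_nonneg_right this (by positivity)
            _ = _ := by ring
  set G : ℕ → Set Ω := fun k => {ω | ∀ n ≤ k, 0 ≤ X n ω ∧ X n ω ≤ N} with hG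
  have hGm : ∀ k, MeasurableSet (G k) := by
    intro k
    have : G k = ⋂ n, ⋂ (_ : n ≤ k), X n ⁻¹' Set.Icc 0 (N : ℤ) := by
      ext ω; simp [G, Set.mem_iInter]
    rw [this]
    exact MeasurableSet.iInter fun n => MeasurableSet.iInter fun _ =>
      hX.measurable n measurableSet_Icc
  -- The weight has mean one. Removing the part with a large energy leaves at least `1/2`, and what
  -- remains is at most `|B|` and vanishes outside `G k`.
  have hBpos : ∀ k, 1 / 2 ≤ |B| * P.real (G k) := by
    intro k
    -- Since `M ≥ 1`, `(i + M) ^ 2 ≤ k` already implies `i ≤ k`; the range only makes the set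
    -- finite.
    set F := (Finset.range (k + 1)).filter fun i => (i + M) ^ 2 ≤ k
    have hwi := hX.integrable (dependsOn_stayWeight (α := α) (β := β) (a := 0) (N := N)
      (n₀ := 0) k)
    have hli : ∀ i ∈ F, Integrable (fun ω => stayWeight α β 0 N 0 k (fun i => X i ω) *
        S.largeEnergy ε (i + M) (fun i => X i ω)) P := by
      intro i hi
      refine hX.integrable (n := 0 + k) (Z := fun x => stayWeight α β 0 N 0 k x *
        S.largeEnergy ε (i + M) x) fun x y h => ?_
      have hi' : (i + M) ^ 2 ≤ k := (Finset.mem_filter.1 hi).2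
      have := S.dependsOn_largeEnergy ε (i + M) (x := x) (y := y) fun l hl =>
        h l (Set.mem_Iic.2 (by have := Set.mem_Iic.1 hl; omega))
      simp only [dependsOn_stayWeight k h, this]
    have hw1 : ∫ ω, stayWeight α β 0 N 0 k (fun i => X i ω) ∂P = 1 := by
      rw [hX.integral_stayWeight hN]
      calc _ = ∫ ω, (1 : ℝ) ∂P := by
            refine integral_congr_ae ?_
            filter_upwards [hX.start] with ω h
            simp only [stayWeight, h]
            rw [if_pos (by omega)]
        _ = 1 := by simp
    have hsum : ∑ i ∈ F, ∫ ω, stayWeight α β 0 N 0 k (fun i => X i ω) *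
        S.largeEnergy ε (i + M) (fun i => X i ω) ∂P ≤ 1 / 2 := by
      calc _ ≤ ∑ i ∈ F, b (i + M) := Finset.sum_le_sum fun i hi =>
            hlarge _ _ (Finset.mem_filter.1 hi).2
        _ ≤ ∑' i, b (i + M) :=
            ((summable_nat_add_iff M).2 hbs).sum_le_tsum _ fun i _ => hb0 _
        _ ≤ 1 / 2 := hM.le
    rw [← integral_finsetSum F hli] at hsum
    calc 1 / 2 ≤ ∫ ω, (stayWeight α β 0 N 0 k (fun i => X i ω) -
          ∑ i ∈ F, stayWeight α β 0 N 0 k (fun i => X i ω) *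
            S.largeEnergy ε (i + M) (fun i => X i ω)) ∂P := by
          rw [integral_sub hwi (integrable_finsetSum F hli), hw1]; linarith
      _ ≤ ∫ ω, (G k).indicator (fun _ => |B|) ω ∂P := by
          refine integral_mono_ae (hwi.sub (integrable_finsetSum F hli))
            ((integrable_const _).indicator (hGm k)) ?_
          filter_upwards [hX.ae_nearest_neighbour] with ω hx
          have hw0 := stayWeight_nonneg (α := α) (β := β) (a := 0) (N := N) (n₀ := 0) k
            fun i => X i ω
          have hrhs : 0 ≤ (G k).indicator (fun _ => |B|) ω :=
            Set.indicator_nonneg (fun _ _ => abs_nonneg B) ω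
          rw [← Finset.mul_sum]
          by_cases hw : stayWeight α β 0 N 0 k (fun i => X i ω) = 0
          · rw [hw]; simpa using hrhs
          have hmem : ω ∈ G k := fun n hn => by
            have := mem_of_stayWeight_ne_zero hw n (by omega) (by omega)
            rwa [zero_add] at this
          by_cases hs : ∀ i ∈ F, S.SmallEnergy ε (i + M) fun i => X i ω
          · have hle := hB (fun i => X i ω) k hx fun m hMm hmk => by
              obtain ⟨i, rfl⟩ := Nat.exists_eq_add_of_le' hMm
              refine hs i (Finset.mem_filter.2 ⟨Finset.mem_range.2 ?_, hmk⟩)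
              nlinarith
            rw [Set.indicator_of_mem hmem]
            have hsn : 0 ≤ ∑ i ∈ F, S.largeEnergy ε (i + M) fun i => X i ω :=
              Finset.sum_nonneg fun i _ => S.largeEnergy_nonneg _ _ _
            have := mul_nonneg hw0 hsn
            linarith [le_abs_self B]
          · push Not at hs
            obtain ⟨i, hi, hsi⟩ := hs
            have hone : 1 ≤ ∑ i ∈ F, S.largeEnergy ε (i + M) fun i => X i ω := by
              refine le_trans ?_ (Finset.single_le_sum
                (f := fun i => S.largeEnergy ε (i + M) fun i => X i ω)
                (fun i _ => S.largeEnergy_nonneg _ _ _) hi)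
              simp only [StreamProfile.largeEnergy, if_neg hsi, le_refl]
            have := mul_le_mul_of_nonneg_left hone hw0
            linarith
      _ = |B| * P.real (G k) := by
          rw [integral_indicator_const _ (hGm k), smul_eq_mul, mul_comm]
  have hinter : {ω | ∀ n, 0 ≤ X n ω ∧ X n ω ≤ N} = ⋂ k, G k := by
    ext ω
    simp only [Set.mem_ofPred_eq, Set.mem_iInter, G]
    exact ⟨fun h k n _ => h n, fun h n => h n n le_rfl⟩
  have hanti : Antitone G := fun i j hij ω h n hn => h n (hn.trans hij)
  have hlim := tendsto_measure_iInter_atTop (μ := P) (fun k => (hGm k).nullMeasurableSet) hanti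
    ⟨0, measure_ne_top P _⟩
  rw [hinter]
  by_contra hcon
  rw [not_lt, nonpos_iff_eq_zero] at hcon
  rw [hcon] at hlim
  have hlim' := ((ENNReal.tendsto_toReal ENNReal.zero_ne_top).comp hlim).const_mul |B|
  have := ge_of_tendsto' hlim' hBpos
  simp at this
  linarith

/-! ### Nearest-neighbour paths that visit finitely many sites infinitely often -/

lemma forall_lt_of_ne {x : ℕ → ℤ} (hx : ∀ n, x (n + 1) = x n + 1 ∨ x (n + 1) = x n - 1) {j : ℤ}
    {n₁ : ℕ} (h : x n₁ < j) (hne : ∀ n, n₁ ≤ n → x n ≠ j) : ∀ n, n₁ ≤ n → x n < j := by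
  intro n hn
  induction n, hn using Nat.le_induction with
  | base => exact h
  | succ n hn ih =>
    have := hne (n + 1) (by omega)
    rcases hx n with h | h <;> omega

lemma forall_gt_of_ne {x : ℕ → ℤ} (hx : ∀ n, x (n + 1) = x n + 1 ∨ x (n + 1) = x n - 1) {j : ℤ}
    {n₁ : ℕ} (h : j < x n₁) (hne : ∀ n, n₁ ≤ n → x n ≠ j) : ∀ n, n₁ ≤ n → j < x n := by
  intro n hn
  induction n, hn using Nat.le_induction with
  | base => exact h
  | succ n hn ih =>
    have := hne (n + 1) (by omega)
    rcases hx n with h | h <;> omega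

/-- If a nearest-neighbour path visits a finite nonempty set of sites infinitely often, this set is
an interval in which the path is eventually confined. -/
lemma exists_confining_interval {x : ℕ → ℤ}
    (hx : ∀ n, x (n + 1) = x n + 1 ∨ x (n + 1) = x n - 1)
    (hne : (visitedInfinitelyOften x).Nonempty) (hfin : (visitedInfinitelyOften x).Finite) :
    ∃ (a : ℤ) (N n₀ : ℕ), 1 ≤ N ∧ visitedInfinitelyOften x = Set.Icc a (a + N) ∧
      ∀ n, n₀ ≤ n → a ≤ x n ∧ x n ≤ a + N := by
  obtain ⟨a, ha, hamin⟩ := hfin.exists_minimal hne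
  obtain ⟨b, hb, hbmax⟩ := hfin.exists_maximal hne
  have hlo : ∀ j ∈ visitedInfinitelyOften x, a ≤ j := fun j hj => by
    by_contra! h
    exact absurd (hamin hj h.le) (not_le.2 h)
  have hhi : ∀ j ∈ visitedInfinitelyOften x, j ≤ b := fun j hj => by
    by_contra! h
    exact absurd (hbmax hj h.le) (not_le.2 h)
  have ha' : ∀ᶠ n in atTop, x n ≠ a - 1 := not_frequently.1 fun h => by
    have := hlo (a - 1) h; omega
  have hb' : ∀ᶠ n in atTop, x n ≠ b + 1 := not_frequently.1 fun h => by
    have := hhi (b + 1) h; omega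
  have hab := hlo b hb
  obtain ⟨n₁, h1⟩ := eventually_atTop.1 (ha'.and hb')
  obtain ⟨n₀, hn₀, hx0⟩ := frequently_atTop.1 ha n₁
  have hgt := forall_gt_of_ne hx (j := a - 1) (n₁ := n₀) (by omega)
    fun n hn => (h1 n (by omega)).1
  have hlt := forall_lt_of_ne hx (j := b + 1) (n₁ := n₀) (by omega)
    fun n hn => (h1 n (by omega)).2
  have hconf : ∀ n, n₀ ≤ n → a ≤ x n ∧ x n ≤ b := fun n hn => by
    have := hgt n hn
    have := hlt n hn
    omega
  have hN : ((b - a).toNat : ℤ) = b - a := by omega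
  refine ⟨a, (b - a).toNat, n₀, ?_, ?_, ?_⟩
  · have h2 := hconf n₀ le_rfl
    have h3 := hconf (n₀ + 1) (by omega)
    rcases hx n₀ with h | h <;> omega
  · rw [hN, add_sub_cancel]
    ext j
    refine ⟨fun hj => ⟨hlo j hj, hhi j hj⟩, fun ⟨hj1, hj2⟩ => ?_⟩
    -- A nearest-neighbour path visiting `a` and `b` infinitely often cannot stop crossing an
    -- intermediate site.
    by_contra hj
    have hja : a ≠ j := fun h => hj (h ▸ ha)
    have hjb : b ≠ j := fun h => hj (h ▸ hb)
    obtain ⟨n₂, h2⟩ := eventually_atTop.1 (not_frequently.1 hj)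
    obtain ⟨n₃, hn₃, hx3⟩ := frequently_atTop.1 ha n₂
    have := forall_lt_of_ne hx (j := j) (n₁ := n₃) (by omega) fun n hn => h2 n (by omega)
    obtain ⟨n₄, hn₄, hx4⟩ := frequently_atTop.1 hb n₃
    have := this n₄ hn₄
    omega
  · intro n hn
    have := hconf n hn
    omega

lemma visitedInfinitelyOften_subset (x : ℕ → ℤ) (n₀ : ℕ) :
    visitedInfinitelyOften x ⊆ sitesVisitedFrom x n₀ := fun _ hj => by
  obtain ⟨n, hn, h⟩ := frequently_atTop.1 hj n₀
  exact ⟨n, hn, h⟩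

/-- Pigeonhole: finitely many sites cannot all be abandoned while the path still occupies one of
them. -/
lemma visitedInfinitelyOften_nonempty {x : ℕ → ℤ} {n₀ : ℕ} (h : (sitesVisitedFrom x n₀).Finite) :
    (visitedInfinitelyOften x).Nonempty := by
  have hev : ∀ᶠ n in atTop, ∃ j ∈ sitesVisitedFrom x n₀, x n = j :=
    (eventually_ge_atTop n₀).mono fun n hn => ⟨x n, ⟨n, hn, rfl⟩, rfl⟩
  by_contra hcon
  rw [Set.not_nonempty_iff_eq_empty] at hcon
  have : ∀ j ∈ sitesVisitedFrom x n₀, ∀ᶠ n in atTop, x n ≠ j := fun j _ =>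
    not_frequently.1 fun h' => by
      have : j ∈ visitedInfinitelyOften x := h'
      rw [hcon] at this
      exact this
  obtain ⟨n, ⟨j, hj, hn⟩, h'⟩ := (hev.and ((Set.Finite.eventually_all h).2 this)).exists
  exact h' j hj hn

/-! ### Counting sites and conclusion -/

lemma encard_Icc_int (a : ℤ) (N : ℕ) : (Set.Icc a (a + N)).encard = (N : ℕ∞) + 1 := by
  rw [← Finset.coe_Icc, Set.encard_coe_eq_coe_finsetCard, Int.card_Icc,
    show (a + (N : ℤ) + 1 - a).toNat = N + 1 by omega]
  push_cast; rfl

/-- Below the critical value the walk is not confined to an interval of at most `L + 1` sites. -/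
lemma IsPushedWalk.ae_not_confined {α β : ℝ} (hβ : 0 < β) {Ω : Type*} [MeasurableSpace Ω]
    {P : Measure Ω} [IsProbabilityMeasure P] {X : ℕ → Ω → ℤ} (hX : IsPushedWalk α β P X) {L : ℕ}
    (h : (α : EReal) < criticalAlpha L) :
    ∀ᵐ ω ∂P, ∀ (N : ℕ) (a : ℤ) (n₀ : ℕ), 1 ≤ N → N ≤ L →
      ¬ ((∀ n, n₀ ≤ n → a ≤ X n ω ∧ X n ω ≤ a + N) ∧ ∃ᶠ n in atTop, X n ω = a) := by
  rw [ae_all_iff]; intro N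
  rw [ae_all_iff]; intro a
  rw [ae_all_iff]; intro n₀
  by_cases hN : 1 ≤ N ∧ N ≤ L
  · rcases le_or_gt α 0 with hα | hα
    · filter_upwards [hX.ae_not_confined_of_nonpos hα hβ N a n₀] with ω h _ _ using h
    · obtain ⟨S, hS⟩ := exists_outward_profile hα hN.1 hN.2 h
      filter_upwards [hX.ae_not_confined_of_outward hα hβ hN.1 S hS a n₀] with ω h _ _ using h
  · exact Eventually.of_forall fun ω h1 h2 => absurd ⟨h1, h2⟩ hN

/-- Below the critical value the walk visits more than `L + 2` sites infinitely often, or none. -/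
lemma IsPushedWalk.ae_many_sites {α β : ℝ} (hβ : 0 < β) {Ω : Type*} [MeasurableSpace Ω]
    {P : Measure Ω} [IsProbabilityMeasure P] {X : ℕ → Ω → ℤ} (hX : IsPushedWalk α β P X) {L : ℕ}
    (h : (α : EReal) < criticalAlpha (L + 1)) :
    ∀ᵐ ω ∂P,
      (visitedInfinitelyOften (fun n => X n ω) = ∅ ∨
        (L : ℕ∞) + 2 < (visitedInfinitelyOften (fun n => X n ω)).encard) ∧
      ∀ n₀ : ℕ, (L : ℕ∞) + 2 < (sitesVisitedFrom (fun n => X n ω) n₀).encard := by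
  filter_upwards [hX.ae_not_confined hβ h, hX.ae_nearest_neighbour] with ω hω hx
  have hL : (L : ℕ∞) + 2 < ⊤ := by
    rw [show (L : ℕ∞) + 2 = ((L + 2 : ℕ) : ℕ∞) by push_cast; rfl]; exact ENat.natCast_lt_top _
  have main : visitedInfinitelyOften (fun n => X n ω) = ∅ ∨
      (L : ℕ∞) + 2 < (visitedInfinitelyOften (fun n => X n ω)).encard := by
    by_contra! hcon
    have hfin := Set.encard_lt_top_iff.1 (hcon.2.trans_lt hL)
    obtain ⟨a, N, n₀, hN, hI, hconf⟩ := exists_confining_interval hx hcon.1 hfin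
    rw [hI, encard_Icc_int] at hcon
    -- An interval with `N` edges has `N + 1` sites.
    have hNL : N ≤ L + 1 := by
      have : ((N + 1 : ℕ) : ℕ∞) ≤ ((L + 2 : ℕ) : ℕ∞) := by push_cast; exact hcon.2
      have := Nat.cast_le.1 this
      omega
    have ha : a ∈ visitedInfinitelyOften (fun n => X n ω) := by
      rw [hI]; exact ⟨le_rfl, by omega⟩
    exact hω N a n₀ hN hNL ⟨hconf, ha⟩
  refine ⟨main, fun n₀ => ?_⟩
  by_contra! hcon
  have hfin := Set.encard_lt_top_iff.1 (hcon.trans_lt hL)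
  rcases main with h' | h'
  · exact (visitedInfinitelyOften_nonempty hfin).ne_empty h'
  · exact absurd (h'.trans_le (Set.encard_le_encard (visitedInfinitelyOften_subset _ n₀)))
      (not_lt.2 hcon)

/-- Between two consecutive critical values the walk gets stuck on `L + 2` sites with positive
probability. -/
lemma IsPushedWalk.stuck_pos {α β : ℝ} (hβ : 0 < β) {Ω : Type*} [MeasurableSpace Ω]
    {P : Measure Ω} [IsProbabilityMeasure P] {X : ℕ → Ω → ℤ} (hX : IsPushedWalk α β P X) {L : ℕ}
    (hL : 1 ≤ L) (h1 : criticalAlpha (L + 1) < (α : EReal)) (h2 : (α : EReal) < criticalAlpha L) :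
    0 < P {ω | (visitedInfinitelyOften (fun n => X n ω)).encard = (L : ℕ∞) + 2} := by
  obtain ⟨hα, S, hS1, hS2⟩ := exists_inward_profile hL h1 h2
  refine (hX.confined_pos hα hβ (by omega) S hS1 (by push_cast; exact hS2)).trans_le
    (measure_mono_ae ?_)
  filter_upwards [hX.ae_nearest_neighbour, hX.ae_tendsto_energy hα hβ (by omega) S 0 0]
    with ω hx hE hc
  have hc' : ∀ n, 0 ≤ n → 0 ≤ X n ω ∧ X n ω ≤ 0 + ((L + 1 : ℕ) : ℤ) := fun n _ => by
    rw [zero_add]; exact hc n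
  have hI : visitedInfinitelyOften (fun n => X n ω) = Set.Icc 0 (0 + ((L + 1 : ℕ) : ℤ)) := by
    ext j
    refine ⟨fun hj => ?_, fun hj => S.frequently_visits hα (by omega) hx hc' (hE hc') hj.1 hj.2⟩
    obtain ⟨n, hn⟩ := Frequently.exists (show ∃ᶠ n in atTop, X n ω = j from hj)
    rw [← hn]
    exact hc' n (Nat.zero_le n)
  change (visitedInfinitelyOften (fun n => X n ω)).encard = (L : ℕ∞) + 2
  rw [hI, encard_Icc_int]
  push_cast
  rw [add_assoc, one_add_one_eq_two]

lemma infinite_of_forall_lt_encard {s : Set ℤ} (h : ∀ L : ℕ, 1 ≤ L → (L : ℕ∞) + 2 < s.encard) :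
    s.Infinite := by
  intro hs
  have h1 := h (s.ncard + 1) (by omega)
  rw [← hs.cast_ncard_eq] at h1
  have : ((s.ncard + 1 + 2 : ℕ) : ℕ∞) < s.ncard := by push_cast; push_cast at h1; exact h1
  have := Nat.cast_lt.1 this
  omega

theorem theorem1 (α β : ℝ) (hβ : 0 < β) {Ω : Type*} [MeasurableSpace Ω] (P : Measure Ω)
    [IsProbabilityMeasure P] (X : ℕ → Ω → ℤ) (hX : IsPushedWalk α β P X) :
    (∀ L : ℕ, 1 ≤ L →
      (criticalAlpha (L + 1) < (α : EReal) → (α : EReal) < criticalAlpha L →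
        0 < P {ω | (visitedInfinitelyOften (fun n => X n ω)).encard = (L : ℕ∞) + 2}) ∧
      ((α : EReal) < criticalAlpha (L + 1) →
        ∀ᵐ ω ∂P,
          (visitedInfinitelyOften (fun n => X n ω) = ∅ ∨
            (L : ℕ∞) + 2 < (visitedInfinitelyOften (fun n => X n ω)).encard) ∧
          ∀ n₀ : ℕ, (L : ℕ∞) + 2 < (sitesVisitedFrom (fun n => X n ω) n₀).encard)) ∧
    (α ≤ 1 / 3 →
      ∀ᵐ ω ∂P,
        (visitedInfinitelyOften (fun n => X n ω) = ∅ ∨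
          (visitedInfinitelyOften (fun n => X n ω)).Infinite) ∧
        ∀ n₀ : ℕ, (sitesVisitedFrom (fun n => X n ω) n₀).Infinite) := by
  refine ⟨fun L hL => ⟨hX.stuck_pos hβ hL, hX.ae_many_sites hβ⟩, fun hα => ?_⟩
  have hall : ∀ᵐ ω ∂P, ∀ L : ℕ, 1 ≤ L →
      (visitedInfinitelyOften (fun n => X n ω) = ∅ ∨
        (L : ℕ∞) + 2 < (visitedInfinitelyOften (fun n => X n ω)).encard) ∧
      ∀ n₀ : ℕ, (L : ℕ∞) + 2 < (sitesVisitedFrom (fun n => X n ω) n₀).encard := by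
    rw [ae_all_iff]
    intro L
    by_cases hL : 1 ≤ L
    · filter_upwards [hX.ae_many_sites hβ (third_lt_criticalAlpha hα (L := L + 1) (by omega))]
        with ω h _ using h
    · exact Eventually.of_forall fun ω h => absurd h hL
  filter_upwards [hall] with ω hω
  refine ⟨?_, fun n₀ => infinite_of_forall_lt_encard fun L hL => (hω L hL).2 n₀⟩
  by_cases he : visitedInfinitelyOften (fun n => X n ω) = ∅
  · exact Or.inl he
  · exact Or.inr (infinite_of_forall_lt_encard fun L hL => (hω L hL).1.resolve_left he)
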